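/- Let $n\ge 2$ be an integer and let $p>n$ be a real number. There is a constant $C''_{p,n}>0$, depending only on $p$ and $n$, such that for every bounded convex domain (non-empty open set) $\Omega\subset\mathbb R^n$ and every integer $k\ge 1$, $$ \sigma_{p,k}\;\le\; C''_{p,n}\left(\frac{k}{|\partial\Omega|}\right)^{\frac{p-1}{n-1}} . $$ Here $|\partial\Omega|$ is the $(n-1)$-dimensional Hausdorff measure of $\partial\Omega$ (normalized so as to agree with Lebesgue measure on hyperplanes), and $\sigma_{p,k}=\sigma_{p,k}(\Omega)$ is the $k$-th variational eigenvalue of the Steklov problem for the $p$-Laplacian, $\mathrm{div}(|\nabla u|^{p-2}\nabla u)=0$ in $\Omega$, $|\nabla u|^{p-2}\frac{\partial u}{\partial\nu}=\sigma|u|^{p-2}u$ on $\partial\Omega$, that is, $$ \sigma_{p,k}:=\inf_{F\in\Gamma_k}\ \sup_{u\in F}\ \frac{\int_\Omega|\nabla u|^p\,dx}{\int_{\partial\Omega}|u|^p\,d\sigma}, $$ where $d\sigma$ is the $(n-1)$-dimensional surface measure on $\partial\Omega$, the boundary values of $u\in W^{1,p}(\Omega)$ are understood in the sense of traces (for $p>n$: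 the values of the representative of $u$ that is continuous on $\overline\Omega$), the quotient is $+\infty$ if its denominator vanishes, and $\Gamma_k$ is the class of all sets $F\subset W^{1,p}(\Omega)\setminus\{0\}$ such that $F=-F$, the set $F\cap\{u:\int_{\partial\Omega}|u|^p\,d\sigma=1\}$ is compact in $W^{1,p}(\Omega)$, and $\gamma(F)\ge k$. The Krasnoselskii genus $\gamma(F)$ is the least integer $\ell$ for which there is a continuous odd map $F\to\mathbb R^\ell\setminus\{0\}$ ($\gamma(F)=\infty$ if there is none, $\gamma(\emptyset)=0$). -/

import Mathlib

open MeasureTheory Filter Topology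
open scoped ENNReal ContDiff

noncomputable section

namespace SteklovP

/-- `g` is the weak gradient of `u` on the open set `Ω ⊆ ℝⁿ`: for every test function
`φ ∈ C_c^∞(Ω)` and every direction `v`, `∫_Ω u ∂_v φ dx = - ∫_Ω φ ⟨g, v⟩ dx`. -/
def IsWeakGradient {n : ℕ} (Ω : Set (EuclideanSpace ℝ (Fin n)))
    (u : EuclideanSpace ℝ (Fin n) → ℝ)
    (g : EuclideanSpace ℝ (Fin n) → EuclideanSpace ℝ (Fin n)) : Prop :=
  ∀ φ : EuclideanSpace ℝ (Fin n) → ℝ, ContDiff ℝ ∞ φ → HasCompactSupport φ → tsupport φ ⊆ Ω →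
    ∀ v : EuclideanSpace ℝ (Fin n),
      ∫ x in Ω, u x * fderiv ℝ φ x v = - ∫ x in Ω, φ x * inner ℝ (g x) v

theorem integrable_mul_test {n : ℕ} {Ω : Set (EuclideanSpace ℝ (Fin n))} {p : ℝ≥0∞}
    (hp : 1 ≤ p) {u ψ : EuclideanSpace ℝ (Fin n) → ℝ} (hu : MemLp u p (volume.restrict Ω))
    (hψ : Continuous ψ) (hc : HasCompactSupport ψ) :
    Integrable (fun x => u x * ψ x) (volume.restrict Ω) := by
  have h1 : LocallyIntegrable u (volume.restrict Ω) := hu.locallyIntegrable hp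
  simpa [smul_eq_mul, mul_comm] using h1.integrable_smul_left_of_hasCompactSupport hψ hc

/-- The Sobolev space `W^{1,p}(Ω)`: the functions `u ∈ L^p(Ω)` with weak gradient in `L^p(Ω)`.
An element is stored as the pair `(u, ∇u)` (the weak gradient is unique, so the pair carries the
same information as `u`). The topology is the one induced from `L^p × L^p`; it is the topology of
the norm `(∫_Ω |∇u|^p + |u|^p)^{1/p}`, to which the product norm is equivalent. -/
def W1p {n : ℕ} (p : ℝ≥0∞) [Fact (1 ≤ p)] (Ω : Set (EuclideanSpace ℝ (Fin n))) :
    Submodule ℝ (Lp ℝ p (volume.restrict Ω) ×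
      Lp (EuclideanSpace ℝ (Fin n)) p (volume.restrict Ω)) where
  carrier := {w | IsWeakGradient Ω w.1 w.2}
  zero_mem' := by
    intro φ _ _ _ v
    have h1 : ∫ x in Ω, (0 : Lp ℝ p (volume.restrict Ω)) x * fderiv ℝ φ x v = 0 := by
      apply integral_eq_zero_of_ae
      filter_upwards [Lp.coeFn_zero ℝ p (volume.restrict Ω)] with x hx
      rw [hx]
      exact zero_mul _
    have h2 : ∫ x in Ω, φ x * inner ℝ
        ((0 : Lp (EuclideanSpace ℝ (Fin n)) p (volume.restrict Ω)) x) v = 0 := by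
      apply integral_eq_zero_of_ae
      filter_upwards [Lp.coeFn_zero (EuclideanSpace ℝ (Fin n)) p (volume.restrict Ω)] with x hx
      rw [hx]
      exact (congrArg (φ x * ·) (inner_zero_left v)).trans (mul_zero _)
    exact h1.trans (by rw [← neg_zero]; exact congrArg Neg.neg h2.symm)
  add_mem' := by
    intro a b ha hb φ hφ hc hs v
    have hp : (1 : ℝ≥0∞) ≤ p := Fact.out
    have hd : Continuous fun x => fderiv ℝ φ x v :=
      (hφ.continuous_fderiv (by simp)).clm_apply continuous_const
    have hdc : HasCompactSupport fun x => fderiv ℝ φ x v := hc.fderiv_apply ℝ v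
    have e1 : ∫ x in Ω, (a + b).1 x * fderiv ℝ φ x v =
        ∫ x in Ω, (a.1 x * fderiv ℝ φ x v + b.1 x * fderiv ℝ φ x v) := by
      apply integral_congr_ae
      filter_upwards [Lp.coeFn_add a.1 b.1] with x hx
      simp only [Prod.fst_add, hx, Pi.add_apply, add_mul]
    have e2 : ∫ x in Ω, φ x * inner ℝ ((a + b).2 x) v =
        ∫ x in Ω, (φ x * inner ℝ (a.2 x) v + φ x * inner ℝ (b.2 x) v) := by
      apply integral_congr_ae
      filter_upwards [Lp.coeFn_add a.2 b.2] with x hx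
      simp only [Prod.snd_add, hx, Pi.add_apply, inner_add_left, mul_add]
    have key : ∀ w : Lp (EuclideanSpace ℝ (Fin n)) p (volume.restrict Ω),
        Integrable (fun x => φ x * inner ℝ (w x) v) (volume.restrict Ω) := by
      intro w
      simpa [mul_comm] using integrable_mul_test hp ((Lp.memLp w).inner_const v) hφ.continuous hc
    rw [e1, e2, integral_add (integrable_mul_test hp (Lp.memLp a.1) hd hdc)
      (integrable_mul_test hp (Lp.memLp b.1) hd hdc), integral_add (key a.2) (key b.2),
      ha φ hφ hc hs v, hb φ hφ hc hs v]
    ring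
  smul_mem' := by
    intro c a ha φ hφ hc hs v
    have e1 : ∫ x in Ω, (c • a).1 x * fderiv ℝ φ x v =
        ∫ x in Ω, c * (a.1 x * fderiv ℝ φ x v) := by
      apply integral_congr_ae
      filter_upwards [Lp.coeFn_smul c a.1] with x hx
      simp only [Prod.smul_fst, hx, Pi.smul_apply, smul_eq_mul, mul_assoc]
    have e2 : ∫ x in Ω, φ x * inner ℝ ((c • a).2 x) v =
        ∫ x in Ω, c * (φ x * inner ℝ (a.2 x) v) := by
      apply integral_congr_ae
      filter_upwards [Lp.coeFn_smul c a.2] with x hx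
      simp only [Prod.smul_snd, hx, Pi.smul_apply, real_inner_smul_left]
      ring
    rw [e1, e2, integral_const_mul, integral_const_mul, ha φ hφ hc hs v]
    ring

/-- The trace of `u ∈ W^{1,p}(Ω)` at a boundary point `x`, as the limit of the means of `u` over
`Ω ∩ B(x, r)` as `r → 0⁺`. On a bounded Lipschitz (in particular, convex) domain and for `p > n`,
`u` has a representative that is continuous on the closure of `Ω`; the limit exists at every
boundary point and is the value of that representative. -/
def trace {n : ℕ} {p : ℝ≥0∞} [Fact (1 ≤ p)] {Ω : Set (EuclideanSpace ℝ (Fin n))}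
    (w : W1p p Ω) (x : EuclideanSpace ℝ (Fin n)) : ℝ :=
  limUnder (𝓝[>] (0 : ℝ)) fun r => ⨍ y in Ω ∩ Metric.ball x r, w.1.1 y

/-- The surface measure on `∂Ω`: the `(n-1)`-dimensional Hausdorff measure (normalized so that it
is the Lebesgue measure on hyperplanes), restricted to `∂Ω`. -/
def surfaceMeasure {n : ℕ} (Ω : Set (EuclideanSpace ℝ (Fin n))) :
    Measure (EuclideanSpace ℝ (Fin n)) :=
  (Measure.euclideanHausdorffMeasure (n - 1)).restrict (frontier Ω)

/-- `|∂Ω|`, the `(n-1)`-dimensional Hausdorff measure of the boundary. -/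
def perimeter {n : ℕ} (Ω : Set (EuclideanSpace ℝ (Fin n))) : ℝ≥0∞ :=
  Measure.euclideanHausdorffMeasure (n - 1) (frontier Ω)

/-- `∫_{∂Ω} |u|^p dσ = ‖u‖_{L^p(∂Ω)}^p`. -/
def boundaryIntegral {n : ℕ} {p : ℝ≥0∞} [Fact (1 ≤ p)] {Ω : Set (EuclideanSpace ℝ (Fin n))}
    (w : W1p p Ω) : ℝ≥0∞ :=
  ∫⁻ x, ‖trace w x‖ₑ ^ p.toReal ∂(surfaceMeasure Ω)

/-- The Rayleigh quotient `∫_Ω |∇u|^p dx / ∫_{∂Ω} |u|^p dσ` with values in `[0, ∞]`; it is `∞` if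
the trace of `u` vanishes while `∇u` does not. -/
def rayleigh {n : ℕ} {p : ℝ≥0∞} [Fact (1 ≤ p)] {Ω : Set (EuclideanSpace ℝ (Fin n))}
    (w : W1p p Ω) : ℝ≥0∞ :=
  (∫⁻ x in Ω, ‖w.1.2 x‖ₑ ^ p.toReal) / boundaryIntegral w

/-- The Krasnoselskii genus of `F`: the least `ℓ` such that there is a continuous odd map
`F → ℝ^ℓ \ {0}`, and `∞` if there is none (`ℓ = 0` occurs only for `F = ∅`). -/
def genus {X : Type*} [TopologicalSpace X] [Neg X] (F : Set X) : ℕ∞ :=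
  ⨅ (ℓ : ℕ) (_ : ∃ f : X → EuclideanSpace ℝ (Fin ℓ), ContinuousOn f F ∧
    (∀ x ∈ F, f (-x) = - f x) ∧ ∀ x ∈ F, f x ≠ 0), (ℓ : ℕ∞)

/-- The class `Γ_k` of the symmetric sets `F ⊆ W^{1,p}(Ω) \ {0}` of genus at least `k` such that
`F ∩ {u : ‖u‖_{L^p(∂Ω)} = 1}` is compact. -/
def Gam {n : ℕ} (p : ℝ≥0∞) [Fact (1 ≤ p)] (Ω : Set (EuclideanSpace ℝ (Fin n))) (k : ℕ) :
    Set (Set (W1p p Ω)) :=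
  {F | (0 : W1p p Ω) ∉ F ∧ IsCompact (F ∩ {w | boundaryIntegral w = 1}) ∧
    (∀ w ∈ F, -w ∈ F) ∧ (k : ℕ∞) ≤ genus F}

/-- The `k`-th variational Steklov eigenvalue of the `p`-Laplacian on `Ω`,
`σ_{p,k} = inf_{F ∈ Γ_k} sup_{u ∈ F} R_p(u)`. -/
def steklovEigenvalue {n : ℕ} (p : ℝ≥0∞) [Fact (1 ≤ p)] (Ω : Set (EuclideanSpace ℝ (Fin n)))
    (k : ℕ) : ℝ≥0∞ :=
  ⨅ F ∈ Gam p Ω k, ⨆ w ∈ F, rayleigh w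

end SteklovP

end

/-!
The eigenvalue is an infimum over sets of genus at least `k`, so one such set with a small maximal
Rayleigh quotient suffices. It is the punctured span of `k` smooth bumps with disjoint supports,
centered at boundary points `x i` at mutual distance at least `2 * r`, each equal to `1` on
`B(x i, r / 2)`, supported in `B(x i, 3 * r / 4)` and with gradient of size `1 / r`.

*Number of centers.* The boundary of a convex set has `(n - 1)`-dimensional measure at most
`C * R ^ (n - 1)` in every ball of radius `R` (`frontier_inter_ball_le`): pushing boundary points
outwards along normals onto the surface of a cube does not decrease distances. Hence fewer than
`k` balls of radius `2 * r` cannot cover the boundary when `r ^ (n - 1)` is a small multiple of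
`|∂Ω| / k`, and a greedy choice finds `k` centers (`exists_separated_points`).

*Rayleigh quotient of one bump.* The numerator is at most `(M / r) ^ p * |Ω ∩ B(x, r)|` and the
denominator at least `|∂Ω ∩ B(x, r / 2)|`. For `x ∈ ∂Ω`, convexity bounds `|Ω ∩ B(x, r)|` by a
multiple of the volume in a smaller concentric ball, and projecting along the coordinate axis
closest to the normal at `x` bounds that volume by `r` times boundary measure
(`volume_inter_ball_le_half`). So the quotient is at most a multiple of `r ^ (1 - p)`, which is the
asserted bound. Since the supports are disjoint, the same bound holds on the whole span
(`steklovEigenvalue_le`).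

*Genus of the span.* That the punctured span has genus at least `k` is the Borsuk–Ulam theorem
(`BorsukUlam.exists_eq_zero_of_odd`). It is proved with mod 2 chains. The iterated barycentric
subdivisions of the hemispheres of the cross-polytope satisfy `∂ h (i + 1) = h i + ν (h i)`, where
`ν` is the antipode. For functions `s 1, …, s ℓ` with values in `ZMod 2` that change under the
antipode, the cup product of their coboundaries is the cochain `[v 0, …, v ℓ] ↦ ∏ j, (s j (v (j - 1)) + s j (v j))`, and the
boundary relation shows by induction that its value on `h ℓ` is `1` (`cup_fineHemisphere`). With
`s j` the sign of the `j`-th component of an odd map, some arbitrarily small simplex therefore has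
a sign change in every component, so the map has a zero by compactness.
-/

namespace BorsukUlam

/-- Mod 2 chains: finite formal sums of ordered simplices, an ordered simplex being the list of
its vertices. Degenerate simplices are not divided out, and the empty list is the simplex of
dimension `-1`, so that the complex is augmented. -/
abbrev Chain (E : Type*) := List E →₀ ZMod 2

/-! ### Mod 2 chains of ordered simplices -/

section Chains

variable {E : Type*}

/-- The cone with apex `v`. -/
noncomputable def cone (v : E) : Chain E →ₗ[ZMod 2] Chain E :=
  Finsupp.lmapDomain _ _ (List.cons v)

/-- The boundary of an ordered simplex: the sum of the lists that arise by deleting one vertex. -/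
noncomputable def bdryList : List E → Chain E
  | [] => 0
  | v :: l => Finsupp.single l 1 + cone v (bdryList l)

/-- The boundary operator of the augmented complex. -/
noncomputable def bdry : Chain E →ₗ[ZMod 2] Chain E :=
  Finsupp.linearCombination (ZMod 2) bdryList

@[simp] theorem cone_single (v : E) (l : List E) (a : ZMod 2) :
    cone v (Finsupp.single l a) = Finsupp.single (v :: l) a := by
  simp [cone]

@[simp] theorem bdry_single (l : List E) : bdry (Finsupp.single l 1) = bdryList l := by
  simp [bdry]

theorem add_self_eq_zero (c : Chain E) : c + c = 0 := by
  ext l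
  exact CharTwo.add_self_eq_zero _

theorem bdry_cone (v : E) (c : Chain E) : bdry (cone v c) = c + cone v (bdry c) := by
  have h : bdry ∘ₗ cone v = LinearMap.id + cone v ∘ₗ bdry := by
    ext1 l
    ext1
    simp [bdryList]
  exact LinearMap.congr_fun h c

theorem bdry_bdryList (l : List E) : bdry (bdryList l) = 0 := by
  induction l with
  | nil => simp [bdryList]
  | cons v l ih => simp [bdryList, bdry_cone, ih, add_self_eq_zero]

theorem bdry_bdry (c : Chain E) : bdry (bdry c) = 0 := by
  have h : (bdry ∘ₗ bdry : Chain E →ₗ[ZMod 2] Chain E) = 0 := by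
    ext1 l
    ext1
    simp [bdry_bdryList]
  exact LinearMap.congr_fun h c

theorem map_mem_supported {β : Type*} {A : Set (List E)} {B : Set β}
    {T : Chain E →ₗ[ZMod 2] β →₀ ZMod 2}
    (hT : ∀ l ∈ A, T (Finsupp.single l 1) ∈ Finsupp.supported (ZMod 2) (ZMod 2) B)
    {c : Chain E} (hc : c ∈ Finsupp.supported (ZMod 2) (ZMod 2) A) :
    T c ∈ Finsupp.supported (ZMod 2) (ZMod 2) B := by
  rw [Finsupp.supported_eq_span_single] at hc
  refine Submodule.span_le (p := (Finsupp.supported (ZMod 2) (ZMod 2) B).comap T).2 ?_ hc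
  rintro _ ⟨l, hl, rfl⟩
  exact hT l hl

theorem single_mem_supported {β : Type*} {B : Set β} {l : β} (h : l ∈ B) (a : ZMod 2) :
    Finsupp.single l a ∈ Finsupp.supported (ZMod 2) (ZMod 2) B :=
  Finsupp.single_mem_supported _ _ h

theorem mapDomain_mem_supported {A B : Set (List E)} {f : List E → List E}
    (hf : ∀ l ∈ A, f l ∈ B)
    {c : Chain E} (hc : c ∈ Finsupp.supported (ZMod 2) (ZMod 2) A) :
    Finsupp.mapDomain f c ∈ Finsupp.supported (ZMod 2) (ZMod 2) B := by
  exact Submodule.sum_mem _ fun l hl => single_mem_supported (hf l (hc hl)) _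

theorem bdryList_mem_supported (l : List E) :
    bdryList l ∈ Finsupp.supported (ZMod 2) (ZMod 2)
      {l' : List E | l'.length + 1 = l.length ∧ ∀ v ∈ l', v ∈ l} := by
  induction l with
  | nil => simp [bdryList]
  | cons v l ih =>
    refine Submodule.add_mem _ (single_mem_supported (by exact ⟨rfl, by simp +contextual⟩) _)
      (mapDomain_mem_supported ?_ ih)
    rintro l' ⟨h1, h2⟩
    refine ⟨by simp [h1], ?_⟩
    intro w hw
    rcases List.mem_cons.1 hw with rfl | hw
    · simp
    · exact List.mem_cons_of_mem _ (h2 w hw)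

end Chains

/-! ### The antipode and the hemispheres of the cross-polytope -/

section Antipode

variable {E : Type*} [AddCommGroup E]

/-- The antipodal map on chains. -/
noncomputable def antipode : Chain E →ₗ[ZMod 2] Chain E :=
  Finsupp.lmapDomain _ _ (List.map Neg.neg)

@[simp] theorem antipode_single (l : List E) (a : ZMod 2) :
    antipode (Finsupp.single l a) = Finsupp.single (l.map Neg.neg) a := by
  simp [antipode]

theorem antipode_antipode (c : Chain E) : antipode (antipode c) = c := by
  have h : (antipode ∘ₗ antipode : Chain E →ₗ[ZMod 2] Chain E) = LinearMap.id := by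
    ext1 l
    ext1
    simp
  exact LinearMap.congr_fun h c

theorem antipode_cone (v : E) (c : Chain E) :
    antipode (cone v c) = cone (-v) (antipode c) := by
  have h : antipode ∘ₗ cone v = cone (-v) ∘ₗ antipode := by
    ext1 l
    ext1
    simp
  exact LinearMap.congr_fun h c

theorem antipode_bdryList (l : List E) : antipode (bdryList l) = bdryList (l.map Neg.neg) := by
  induction l with
  | nil => simp [bdryList]
  | cons v l ih => simp [bdryList, antipode_cone, ih]

theorem antipode_bdry (c : Chain E) : antipode (bdry c) = bdry (antipode c) := by
  have h : (antipode ∘ₗ bdry : Chain E →ₗ[ZMod 2] Chain E) = bdry ∘ₗ antipode := by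
    ext1 l
    ext1
    simp [antipode_bdryList]
  exact LinearMap.congr_fun h c

/-- The chain of the `i`-dimensional upper hemisphere of the cross-polytope with vertices `± e j`.
Its boundary is the equator, that is, the sum of the two hemispheres of dimension `i - 1`. -/
noncomputable def hemisphere (e : ℕ → E) : ℕ → Chain E
  | 0 => Finsupp.single [e 0] 1
  | i + 1 => cone (e (i + 1)) (hemisphere e i + antipode (hemisphere e i))

theorem bdry_hemisphere_zero (e : ℕ → E) : bdry (hemisphere e 0) = Finsupp.single [] 1 := by
  simp [hemisphere, bdryList]

theorem bdry_hemisphere_succ (e : ℕ → E) (i : ℕ) :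
    bdry (hemisphere e (i + 1)) = hemisphere e i + antipode (hemisphere e i) := by
  have h : bdry (hemisphere e i + antipode (hemisphere e i)) = 0 := by
    induction i with
    | zero =>
      rw [map_add, ← antipode_bdry, bdry_hemisphere_zero]
      simp [add_self_eq_zero]
    | succ i ih =>
      have h1 : bdry (hemisphere e (i + 1)) = hemisphere e i + antipode (hemisphere e i) := by
        rw [hemisphere, bdry_cone, ih]; simp
      rw [map_add, ← antipode_bdry, h1, map_add, antipode_antipode,
        add_comm (antipode _), add_self_eq_zero]
  rw [hemisphere, bdry_cone, h]
  simp

end Antipode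

/-! ### Barycentric subdivision -/

section Subdivision

variable {E : Type*} [AddCommGroup E] [Module ℝ E]

/-- The barycenter of the vertices. -/
noncomputable def bary (l : List E) : E := (l.length : ℝ)⁻¹ • l.sum

theorem bary_map_neg (l : List E) : bary (l.map Neg.neg) = -bary l := by
  have h : (l.map Neg.neg).sum = -l.sum := by
    induction l with
    | nil => simp
    | cons v l ih => simp [ih, add_comm]
  simp [bary, h]

/-- The barycentric subdivision of lists with `n` vertices: the cone from the barycenter over the
subdivided boundary. With the number of vertices as an explicit argument, the recursion is
structural and the operator commutes with the boundary without a restriction to homogeneous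
chains. -/
noncomputable def sd : ℕ → Chain E →ₗ[ZMod 2] Chain E
  | 0 => Finsupp.linearCombination (ZMod 2) fun _ => Finsupp.single [] 1
  | n + 1 => Finsupp.linearCombination (ZMod 2) fun l => cone (bary l) (sd n (bdryList l))

theorem sd_zero_single (l : List E) :
    sd 0 (Finsupp.single l 1) = Finsupp.single [] 1 := by
  simp [sd]

theorem sd_succ_single (n : ℕ) (l : List E) :
    sd (n + 1) (Finsupp.single l 1) = cone (bary l) (sd n (bdryList l)) := by
  simp [sd]

theorem bdry_sd_zero (c : Chain E) : bdry (sd 0 c) = 0 := by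
  have h : (bdry ∘ₗ sd 0 : Chain E →ₗ[ZMod 2] Chain E) = 0 := by
    ext1 l
    ext1
    simp [sd_zero_single, bdryList]
  exact LinearMap.congr_fun h c

theorem bdry_sd_succ (n : ℕ) (c : Chain E) : bdry (sd (n + 1) c) = sd n (bdry c) := by
  induction n generalizing c with
  | zero =>
    have h : (bdry ∘ₗ sd (0 + 1) : Chain E →ₗ[ZMod 2] Chain E) = sd 0 ∘ₗ bdry := by
      ext1 l
      ext1
      simp only [LinearMap.comp_apply, Finsupp.lsingle_apply]
      rw [sd_succ_single, bdry_cone, bdry_sd_zero]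
      simp
    exact LinearMap.congr_fun h c
  | succ n ih =>
    have h : (bdry ∘ₗ sd (n + 1 + 1) : Chain E →ₗ[ZMod 2] Chain E) = sd (n + 1) ∘ₗ bdry := by
      ext1 l
      ext1
      simp only [LinearMap.comp_apply, Finsupp.lsingle_apply]
      rw [sd_succ_single, bdry_cone, ih, bdry_bdryList]
      simp
    exact LinearMap.congr_fun h c

theorem antipode_sd (n : ℕ) (c : Chain E) : antipode (sd n c) = sd n (antipode c) := by
  induction n generalizing c with
  | zero =>
    have h : (antipode ∘ₗ sd 0 : Chain E →ₗ[ZMod 2] Chain E) = sd 0 ∘ₗ antipode := by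
      ext1 l
      ext1
      simp [sd_zero_single]
    exact LinearMap.congr_fun h c
  | succ n ih =>
    have h : (antipode ∘ₗ sd (n + 1) : Chain E →ₗ[ZMod 2] Chain E) = sd (n + 1) ∘ₗ antipode := by
      ext1 l
      ext1
      simp only [LinearMap.comp_apply, Finsupp.lsingle_apply, antipode_single]
      rw [sd_succ_single, sd_succ_single, antipode_cone, ih, antipode_bdryList, bary_map_neg]
    exact LinearMap.congr_fun h c

/-- The `N`-fold subdivided `i`-dimensional hemisphere. -/
noncomputable def fineHemisphere (e : ℕ → E) (N i : ℕ) : Chain E :=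
  (sd (i + 1))^[N] (hemisphere e i)

theorem bdry_iterate_sd (N n : ℕ) (c : Chain E) :
    bdry ((sd (n + 1))^[N] c) = (sd n)^[N] (bdry c) := by
  induction N generalizing c with
  | zero => rfl
  | succ N ih => rw [Function.iterate_succ_apply, ih, bdry_sd_succ, Function.iterate_succ_apply]

theorem bdry_fineHemisphere_zero (e : ℕ → E) (N : ℕ) :
    bdry (fineHemisphere e N 0) = Finsupp.single [] 1 := by
  rw [fineHemisphere, bdry_iterate_sd, bdry_hemisphere_zero]
  exact Function.iterate_fixed (sd_zero_single _) N

theorem bdry_fineHemisphere_succ (e : ℕ → E) (N i : ℕ) :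
    bdry (fineHemisphere e N (i + 1)) =
      fineHemisphere e N i + antipode (fineHemisphere e N i) := by
  have h1 : ∀ c d : Chain E, (sd (i + 1))^[N] (c + d) =
      (sd (i + 1))^[N] c + (sd (i + 1))^[N] d := by
    induction N with
    | zero => simp
    | succ N ih => intro c d; simp only [Function.iterate_succ_apply, map_add, ih]
  have h2 : ∀ c : Chain E, (sd (i + 1))^[N] (antipode c) = antipode ((sd (i + 1))^[N] c) := by
    clear h1
    induction N with
    | zero => simp
    | succ N ih => intro c; simp only [Function.iterate_succ_apply, ← antipode_sd, ih]
  rw [fineHemisphere, bdry_iterate_sd, bdry_hemisphere_succ, h1, h2, fineHemisphere]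

end Subdivision

/-! ### Cup products of sign coboundaries -/

section Cochains

variable {E : Type*}

/-- The cup product of the coboundaries of the `0`-cochains in `S = [s₁, …, sₙ]`: its value on
the simplex `[v₀, …, vₙ]` is `∏ j, (s j (v (j-1)) + s j (v j))`. For empty `S` it is the
augmentation, which is written here as the coefficient of the empty list in the boundary. -/
noncomputable def cup : List (E → ZMod 2) → Chain E →ₗ[ZMod 2] ZMod 2
  | [] => (Finsupp.lapply []) ∘ₗ bdry
  | s :: S => Finsupp.linearCombination (ZMod 2) fun l =>
      match l with
      | v :: v' :: l => (s v + s v') * cup S (Finsupp.single (v' :: l) 1)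
      | _ => 0

/-- The product of the `0`-cochain `s` with the cocycle `cup S`. -/
noncomputable def cupPrimitive (s : E → ZMod 2) (S : List (E → ZMod 2)) :
    Chain E →ₗ[ZMod 2] ZMod 2 :=
  Finsupp.linearCombination (ZMod 2) fun l =>
    match l with
    | v :: l => s v * cup S (Finsupp.single (v :: l) 1)
    | [] => 0

theorem cupPrimitive_cone (s : E → ZMod 2) (S : List (E → ZMod 2)) (v : E) (c : Chain E) :
    cupPrimitive s S (cone v c) = s v * cup S (cone v c) := by
  have h : cupPrimitive s S ∘ₗ cone v = s v • (cup S ∘ₗ cone v) := by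
    ext1 l
    ext1
    simp [cupPrimitive]
  exact LinearMap.congr_fun h c

/-- `cup S` is a cocycle, and the coboundary of `cupPrimitive s S` is `cup (s :: S)`. -/
theorem cup_bdry_and (S : List (E → ZMod 2)) :
    (∀ c, cup S (bdry c) = 0) ∧ ∀ s c, cupPrimitive s S (bdry c) = cup (s :: S) c := by
  have key : ∀ S : List (E → ZMod 2), (∀ c, cup S (bdry c) = 0) →
      ∀ s c, cupPrimitive s S (bdry c) = cup (s :: S) c := by
    intro S hS s c
    have h : cupPrimitive s S ∘ₗ bdry = cup (s :: S) := by
      ext1 l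
      ext1
      simp only [LinearMap.comp_apply, Finsupp.lsingle_apply, bdry_single]
      match l with
      | [] => simp [bdryList, cup]
      | [v] => simp [bdryList, cup, cupPrimitive]
      | v :: v' :: l =>
        have h0 := hS (Finsupp.single (v :: v' :: l) 1)
        rw [bdry_single, bdryList, map_add] at h0
        rw [bdryList, map_add, cupPrimitive_cone, ← CharTwo.add_eq_zero.1 h0]
        simp [cupPrimitive, cup]
        ring
    exact LinearMap.congr_fun h c
  suffices h : ∀ c, cup S (bdry c) = 0 from ⟨h, key S h⟩
  induction S with
  | nil => intro c; simp [cup, bdry_bdry]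
  | cons s S ih => intro c; rw [← key S ih, bdry_bdry, map_zero]

theorem exists_ne_of_cup_ne_zero {S : List (E → ZMod 2)} {l : List E}
    (h : cup S (Finsupp.single l 1) ≠ 0) {s : E → ZMod 2} (hs : s ∈ S) :
    ∃ v ∈ l, ∃ w ∈ l, s v ≠ s w := by
  induction S generalizing l with
  | nil => simp at hs
  | cons t S ih =>
    match l with
    | [] => simp [cup] at h
    | [v] => simp [cup] at h
    | v :: v' :: l =>
      simp only [cup, Finsupp.linearCombination_single, one_smul] at h
      rcases List.mem_cons.1 hs with rfl | hs
      · refine ⟨v, by simp, v', by simp, fun h' => h ?_⟩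
        rw [h', CharTwo.add_self_eq_zero, zero_mul]
      · obtain ⟨a, ha, b, hb, hab⟩ := ih (right_ne_zero_of_mul h) hs
        exact ⟨a, List.mem_cons_of_mem _ ha, b, List.mem_cons_of_mem _ hb, hab⟩

end Cochains

/-! ### Evaluation on the hemispheres -/

section Evaluation

variable {E : Type*} [AddCommGroup E]

theorem cup_map_neg {S : List (E → ZMod 2)} {l : List E}
    (h : ∀ s ∈ S, ∀ v ∈ l, s (-v) = s v + 1) :
    cup S (Finsupp.single (l.map Neg.neg) 1) = cup S (Finsupp.single l 1) := by
  induction S generalizing l with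
  | nil =>
    have h1 : Finsupp.single (l.map Neg.neg) (1 : ZMod 2) = antipode (Finsupp.single l 1) := by
      simp
    have h2 : ∀ c : Chain E, antipode c [] = c [] := by
      intro c
      have h : (Finsupp.lapply [] ∘ₗ antipode : Chain E →ₗ[ZMod 2] ZMod 2) =
          Finsupp.lapply [] := by
        ext1 l
        ext1
        simp [Finsupp.single_apply]
      exact LinearMap.congr_fun h c
    rw [h1]
    simp only [cup, LinearMap.comp_apply, ← antipode_bdry]
    exact h2 _
  | cons s S ih =>
    match l with
    | [] => rfl
    | [v] => simp [cup]
    | v :: v' :: l =>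
      have h1 := ih (l := v' :: l) fun t ht w hw =>
        h t (List.mem_cons_of_mem _ ht) w (List.mem_cons_of_mem _ hw)
      simp only [List.map_cons] at h1
      simp only [cup, List.map_cons, Finsupp.linearCombination_single, one_smul, h1]
      rw [h s (by simp) v (by simp), h s (by simp) v' (by simp)]
      have : s v + 1 + (s v' + 1) = s v + s v' := by
        rw [add_add_add_comm, CharTwo.add_self_eq_zero (1 : ZMod 2), add_zero]
      rw [this]

/-- On a simplex and its antipode, the factor `s v` takes both values and the factor `cup S` is the
same. -/
theorem cupPrimitive_add_antipode {s : E → ZMod 2} {S : List (E → ZMod 2)} {A : Set (List E)}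
    (hA : ∀ l ∈ A, l ≠ [] ∧ ∀ t ∈ s :: S, ∀ v ∈ l, t (-v) = t v + 1) {c : Chain E}
    (hc : c ∈ Finsupp.supported (ZMod 2) (ZMod 2) A) :
    cupPrimitive s S (c + antipode c) = cup S c := by
  have key : ∀ l ∈ A, cupPrimitive s S (Finsupp.single l 1 + antipode (Finsupp.single l 1)) =
      cup S (Finsupp.single l 1) := by
    intro l hl
    obtain ⟨hne, hl⟩ := hA l hl
    match l with
    | [] => exact absurd rfl hne
    | v :: l =>
      have h1 := cup_map_neg (S := S) (l := v :: l) fun t ht => hl t (List.mem_cons_of_mem _ ht)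
      simp only [List.map_cons] at h1
      simp only [cupPrimitive, map_add, antipode_single, List.map_cons,
        Finsupp.linearCombination_single, one_smul, h1, hl s (by simp) v (by simp)]
      rw [← add_mul, ← add_assoc, CharTwo.add_self_eq_zero, zero_add, one_mul]
  rw [Finsupp.supported_eq_span_single] at hc
  induction hc using Submodule.span_induction with
  | mem x hx => obtain ⟨l, hl, rfl⟩ := hx; exact key l hl
  | zero => simp
  | add x y _ _ hx hy =>
    have : x + y + antipode (x + y) = (x + antipode x) + (y + antipode y) := by
      rw [map_add]; abel
    rw [this, map_add, hx, hy, map_add]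
  | smul a x _ hx => rw [map_smul, ← smul_add, map_smul, hx, map_smul]

/-- The cup product of sign cochains takes the value `1` on the hemisphere, for all functions `s`
that change under the antipode: lowering the dimension by one trades the factor `s v + s v'` for
the boundary, which is the hemisphere plus its antipode, where `s` contributes exactly `1`. -/
theorem cup_fineHemisphere [Module ℝ E] {e : ℕ → E} {N : ℕ} {S : List (E → ZMod 2)}
    (hS : ∀ i < S.length, fineHemisphere e N i ∈ Finsupp.supported (ZMod 2) (ZMod 2)
      {l : List E | l ≠ [] ∧ ∀ s ∈ S, ∀ v ∈ l, s (-v) = s v + 1}) :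
    cup S (fineHemisphere e N S.length) = 1 := by
  induction S with
  | nil => simp [cup, bdry_fineHemisphere_zero]
  | cons s S ih =>
    rw [List.length_cons, ← (cup_bdry_and S).2, bdry_fineHemisphere_succ,
      cupPrimitive_add_antipode (fun l hl => hl) (hS S.length (by simp))]
    refine ih fun i hi => Finsupp.supported_mono ?_ (hS i (by simp; omega))
    exact fun l hl => ⟨hl.1, fun t ht => hl.2 t (List.mem_cons_of_mem _ ht)⟩

end Evaluation

/-! ### The mesh of subdivisions, and the Borsuk–Ulam theorem -/

section Mesh

variable {E : Type*} [NormedAddCommGroup E] [NormedSpace ℝ E]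

theorem bary_eq_sum (l : List E) : bary l = ∑ i : Fin l.length, (l.length : ℝ)⁻¹ • l[i] := by
  rw [bary, ← Finset.smul_sum]
  congr 1
  exact (Fin.sum_univ_getElem l).symm

theorem bary_mem {l : List E} (hl : l ≠ []) {K : Set E} (hK : Convex ℝ K) (h : ∀ v ∈ l, v ∈ K) :
    bary l ∈ K := by
  have hpos : (0 : ℝ) < l.length := by exact_mod_cast List.length_pos_iff.2 hl
  rw [bary_eq_sum]
  refine hK.sum_mem (fun i _ => by positivity) ?_ fun i _ => h _ (List.getElem_mem _)
  simp [hpos.ne']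

theorem dist_bary_le {l : List E} {n : ℕ} (hl : l.length = n + 1) {δ : ℝ}
    (h : ∀ v ∈ l, ∀ w ∈ l, dist v w ≤ δ) {v : E} (hv : v ∈ l) :
    dist v (bary l) ≤ n / (n + 1) * δ := by
  obtain ⟨j, hj, rfl⟩ := List.getElem_of_mem hv
  have hpos : (0 : ℝ) < n + 1 := by positivity
  have hlen : (l.length : ℝ) = n + 1 := by rw [hl]; push_cast; rfl
  have h1 : l[j] - bary l = ∑ i : Fin l.length, (l.length : ℝ)⁻¹ • (l[j] - l[i]) := by
    rw [bary_eq_sum]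
    simp only [smul_sub, Finset.sum_sub_distrib]
    congr 1
    rw [Finset.sum_const, Finset.card_univ, Fintype.card_fin, ← Nat.cast_smul_eq_nsmul ℝ, smul_smul,
      mul_inv_cancel₀ (by rw [hlen]; exact hpos.ne'), one_smul]
  rw [dist_eq_norm, h1, ← Finset.add_sum_erase _ _ (Finset.mem_univ (⟨j, hj⟩ : Fin l.length))]
  simp only [Fin.getElem_fin, sub_self, smul_zero, zero_add]
  refine (norm_sum_le_of_le (f := fun i : Fin l.length => (l.length : ℝ)⁻¹ • (l[j] - l[(i : ℕ)]))
    (n := fun _ => (n + 1 : ℝ)⁻¹ * δ) _ fun i _ => ?_).trans ?_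
  · rw [norm_smul, hlen, norm_inv, Real.norm_of_nonneg hpos.le, ← dist_eq_norm]
    exact mul_le_mul_of_nonneg_left (h _ hv _ (List.getElem_mem _)) (by positivity)
  · rw [Finset.sum_const, Finset.card_erase_of_mem (Finset.mem_univ _), Finset.card_univ,
      Fintype.card_fin, hl, nsmul_eq_mul]
    simp only [Nat.add_sub_cancel]
    exact le_of_eq (by field_simp)

/-- Subdivision of simplices with at most `m` vertices shrinks the mesh by the factor `1 - 1/m`
and does not leave the convex hull of a simplex. -/
theorem sd_single_mem_supported {m : ℕ} (hm : 1 ≤ m) {n : ℕ} (hn : n ≤ m) {l : List E}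
    (hl : l.length = n) {δ : ℝ} (hδ : 0 ≤ δ) (h : ∀ v ∈ l, ∀ w ∈ l, dist v w ≤ δ) :
    sd n (Finsupp.single l 1) ∈ Finsupp.supported (ZMod 2) (ZMod 2)
      {l' : List E | l'.length = n ∧
        (∀ K : Set E, Convex ℝ K → (∀ v ∈ l, v ∈ K) → ∀ v ∈ l', v ∈ K) ∧
        ∀ v ∈ l', ∀ w ∈ l', dist v w ≤ (1 - 1 / m) * δ} := by
  have hq : 0 ≤ (1 - 1 / m : ℝ) * δ := by
    refine mul_nonneg (sub_nonneg.2 ?_) hδ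
    exact div_le_one_of_le₀ (by exact_mod_cast hm) (by positivity)
  induction n generalizing l with
  | zero =>
    rw [sd_zero_single]
    exact single_mem_supported (by simp) _
  | succ n ih =>
    rw [sd_succ_single]
    have hne : l ≠ [] := by rintro rfl; simp at hl
    have hb : ∀ v ∈ l, dist v (bary l) ≤ (1 - 1 / m) * δ := by
      intro v hv
      refine (dist_bary_le hl h hv).trans (mul_le_mul_of_nonneg_right ?_ hδ)
      have h1 : (n : ℝ) / (n + 1) = 1 - 1 / (n + 1) := by field_simp; ring
      rw [h1]
      have : ((n : ℝ) + 1) ≤ m := by exact_mod_cast hn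
      have := one_div_le_one_div_of_le (by positivity : (0 : ℝ) < n + 1) this
      linarith
    have h1 : sd n (bdryList l) ∈ Finsupp.supported (ZMod 2) (ZMod 2)
      {l' : List E | l'.length = n ∧
        (∀ K : Set E, Convex ℝ K → (∀ v ∈ l, v ∈ K) → ∀ v ∈ l', v ∈ K) ∧
        ∀ v ∈ l', ∀ w ∈ l', dist v w ≤ (1 - 1 / m) * δ} := by
      have h2 := bdryList_mem_supported l
      refine map_mem_supported ?_ h2
      rintro l0 ⟨h4, h5⟩
      refine Finsupp.supported_mono ?_ (ih (by omega) (by omega)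
        fun v hv w hw => h v (h5 v hv) w (h5 w hw))
      exact fun l' hl' => ⟨hl'.1, fun K hK hlK => hl'.2.1 K hK fun v hv => hlK v (h5 v hv),
        hl'.2.2⟩
    refine mapDomain_mem_supported ?_ h1
    rintro l' ⟨h4, h5, h6⟩
    have h7 : ∀ w ∈ l', dist w (bary l) ≤ (1 - 1 / m) * δ := fun w hw =>
      h5 (Metric.closedBall (bary l) ((1 - 1 / m) * δ)) (convex_closedBall _ _) hb w hw
    refine ⟨by simp [h4], ?_, ?_⟩
    · intro K hK hlK v hv
      rcases List.mem_cons.1 hv with rfl | hv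
      · exact bary_mem hne hK hlK
      · exact h5 K hK hlK v hv
    · intro v hv w hw
      rcases List.mem_cons.1 hv with rfl | hv <;> rcases List.mem_cons.1 hw with rfl | hw
      · rw [dist_self]; exact hq
      · rw [dist_comm]; exact h7 w hw
      · exact h7 v hv
      · exact h6 v hv w hw

theorem iterate_sd_mem_supported {m : ℕ} (hm : 1 ≤ m) {𝒦 : Set (Set E)}
    (h𝒦 : ∀ K ∈ 𝒦, Convex ℝ K) {δ : ℝ} (hδ : 0 ≤ δ) {c : Chain E}
    (hc : c ∈ Finsupp.supported (ZMod 2) (ZMod 2) {l : List E | l.length = m ∧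
      (∃ K ∈ 𝒦, ∀ v ∈ l, v ∈ K) ∧ ∀ v ∈ l, ∀ w ∈ l, dist v w ≤ δ}) (N : ℕ) :
    (sd m)^[N] c ∈ Finsupp.supported (ZMod 2) (ZMod 2) {l : List E | l.length = m ∧
      (∃ K ∈ 𝒦, ∀ v ∈ l, v ∈ K) ∧ ∀ v ∈ l, ∀ w ∈ l, dist v w ≤ (1 - 1 / m) ^ N * δ} := by
  induction N with
  | zero => simpa using hc
  | succ N ih =>
    rw [Function.iterate_succ_apply']
    refine map_mem_supported ?_ ih
    rintro l ⟨h4, ⟨K, hK, hlK⟩, h5⟩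
    have hq : 0 ≤ (1 - 1 / m : ℝ) := sub_nonneg.2 <|
      div_le_one_of_le₀ (by exact_mod_cast hm) (by positivity)
    refine Finsupp.supported_mono ?_ (sd_single_mem_supported hm le_rfl h4
      (mul_nonneg (pow_nonneg hq N) hδ) h5)
    rintro l' ⟨h6, h7, h8⟩
    refine ⟨h6, ⟨K, hK, h7 K (h𝒦 K hK) hlK⟩, fun v hv w hw => (h8 v hv w hw).trans_eq ?_⟩
    ring

end Mesh

/-! ### The Borsuk–Ulam theorem -/

/-- The vectors of the unit ball on which the functional with coefficients `ε` is `1`. For a sign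
vector `ε` this contains a face of the cross-polytope. It is convex, hence preserved by
subdivision, and for `|ε i| ≤ 1` it stays away from the origin. -/
def slab {k : ℕ} (ε : Fin k → ℝ) : Set (EuclideanSpace ℝ (Fin k)) :=
  {v | ‖v‖ ≤ 1 ∧ ∑ i, ε i * v i = 1}

theorem convex_slab {k : ℕ} (ε : Fin k → ℝ) : Convex ℝ (slab ε) := by
  intro x hx y hy a b ha hb hab
  refine ⟨?_, ?_⟩
  · refine (norm_add_le _ _).trans ?_
    rw [norm_smul, norm_smul, Real.norm_of_nonneg ha, Real.norm_of_nonneg hb]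
    nlinarith [hx.1, hy.1]
  · have : ∀ i, ε i * (a • x + b • y) i = a * (ε i * x i) + b * (ε i * y i) := by
      intro i; simp; ring
    simp_rw [this]
    rw [Finset.sum_add_distrib, ← Finset.mul_sum, ← Finset.mul_sum, hx.2, hy.2]
    simpa using hab

/-- The simplices of the hemisphere lie in slabs. The vanishing of the later coordinates makes it
possible to choose the next entry of `ε` freely when the cone is formed. -/
theorem hemisphere_mem_supported {k : ℕ} {e : ℕ → EuclideanSpace ℝ (Fin k)}
    (he : ∀ i : Fin k, e i = EuclideanSpace.single i 1) {i : ℕ} (hi : i < k) :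
    hemisphere e i ∈ Finsupp.supported (ZMod 2) (ZMod 2)
      {l : List (EuclideanSpace ℝ (Fin k)) | l.length = i + 1 ∧
        ∃ ε : Fin k → ℝ, (∀ j, |ε j| ≤ 1) ∧
          ∀ v ∈ l, v ∈ slab ε ∧ ∀ j : Fin k, i < j → v j = 0} := by
  induction i with
  | zero =>
    refine single_mem_supported ?_ _
    refine ⟨rfl, fun _ => 1, by simp, ?_⟩
    intro v hv
    obtain rfl := List.mem_singleton.1 hv
    rw [he ⟨0, hi⟩]
    refine ⟨⟨by simp, by simp⟩, fun j hj => ?_⟩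
    have : j ≠ ⟨0, hi⟩ := by rintro rfl; simp at hj
    simp [this]
  | succ i ih =>
    have ih := ih (by omega)
    have h2 : hemisphere e i + antipode (hemisphere e i) ∈ Finsupp.supported (ZMod 2) (ZMod 2)
      {l : List (EuclideanSpace ℝ (Fin k)) | l.length = i + 1 ∧
        ∃ ε : Fin k → ℝ, (∀ j, |ε j| ≤ 1) ∧
          ∀ v ∈ l, v ∈ slab ε ∧ ∀ j : Fin k, i < j → v j = 0} := by
      refine Submodule.add_mem _ ih (mapDomain_mem_supported ?_ ih)
      rintro l ⟨h1, ε, hε, h3⟩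
      refine ⟨by simp [h1], -ε, by simpa using hε, ?_⟩
      intro v hv
      obtain ⟨w, hw, rfl⟩ := List.mem_map.1 hv
      obtain ⟨⟨h4, h5⟩, h6⟩ := h3 w hw
      exact ⟨⟨by simpa using h4, by simpa using h5⟩, fun j hj => by simp [h6 j hj]⟩
    refine mapDomain_mem_supported ?_ h2
    rintro l ⟨h1, ε, hε, h3⟩
    refine ⟨by simp [h1], Function.update ε ⟨i + 1, hi⟩ 1, ?_, ?_⟩
    · intro j
      by_cases hj : j = ⟨i + 1, hi⟩
      · subst hj; simp
      · rw [Function.update_of_ne hj]; exact hε j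
    · intro v hv
      rcases List.mem_cons.1 hv with rfl | hv
      · rw [he ⟨i + 1, hi⟩]
        refine ⟨⟨by simp, by simp⟩, fun j hj => ?_⟩
        have : j ≠ ⟨i + 1, hi⟩ := by rintro rfl; simp at hj
        simp [this]
      · obtain ⟨⟨h4, h5⟩, h6⟩ := h3 v hv
        refine ⟨⟨h4, ?_⟩, fun j hj => h6 j (by omega)⟩
        rw [← h5]
        refine Finset.sum_congr rfl fun j _ => ?_
        by_cases hj : j = ⟨i + 1, hi⟩
        · subst hj; simp [h6]
        · rw [Function.update_of_ne hj]

/-- A choice of one vector from each pair `{x, -x}`, by means of a well-ordering. -/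
theorem exists_antisymmetric_pred (E : Type*) [AddCommGroup E] [Module ℝ E] :
    ∃ t : E → Prop, ∀ x, x ≠ 0 → (t (-x) ↔ ¬ t x) := by
  refine ⟨fun x => WellOrderingRel x (-x), fun x hx => ?_⟩
  have hne : x ≠ -x := fun h => hx <| by
    have h2 : (2 : ℝ) • x = 0 := by rw [two_smul]; nth_rw 2 [h]; exact add_neg_cancel x
    exact (smul_eq_zero.1 h2).resolve_left two_ne_zero
  simp only [neg_neg]
  constructor
  · exact fun h h' => asymm_of WellOrderingRel h h'
  · intro h
    rcases trichotomous_of (WellOrderingRel (α := E)) x (-x) with h' | h' | h'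
    · exact absurd h' h
    · exact absurd h' hne
    · exact h'

/-- The **Borsuk–Ulam theorem**: a continuous odd map from the punctured space of dimension `k` to
a space of smaller dimension has a zero. -/
theorem exists_eq_zero_of_odd {k ℓ : ℕ} (hℓ : ℓ < k)
    {g : EuclideanSpace ℝ (Fin k) → EuclideanSpace ℝ (Fin ℓ)} (hg : ContinuousOn g {0}ᶜ)
    (hodd : ∀ x ≠ 0, g (-x) = -g x) : ∃ x ≠ 0, g x = 0 := by
  classical
  by_contra! hne
  -- The subdivided hemispheres lie in this compact set, whatever the number of subdivisions.
  set A : Set (EuclideanSpace ℝ (Fin k)) := {v | ‖v‖ ≤ 1 ∧ 1 ≤ ∑ i, |v i|} with hA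
  have hAc : IsCompact A := by
    refine Metric.isCompact_of_isClosed_isBounded ?_ ?_
    · exact (isClosed_le continuous_norm continuous_const).inter
        (isClosed_le continuous_const
        (continuous_finsetSum _ fun i _ =>
          (by fun_prop : Continuous fun v : EuclideanSpace ℝ (Fin k) => |v i|)))
    · refine (Metric.isBounded_closedBall (x := 0) (r := 1)).subset ?_
      intro v hv
      simpa using hv.1
  have hA0 : ∀ v ∈ A, v ≠ 0 := by
    rintro v hv rfl
    have := hv.2
    simp at this
    linarith
  have hsA : ∀ ε : Fin k → ℝ, (∀ j, |ε j| ≤ 1) → slab ε ⊆ A := by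
    intro ε hε v hv
    refine ⟨hv.1, ?_⟩
    rw [← hv.2]
    refine Finset.sum_le_sum fun i _ => (le_abs_self _).trans ?_
    rw [abs_mul]
    exact mul_le_of_le_one_left (abs_nonneg _) (hε i)
  have hgA : ContinuousOn g A := hg.mono fun v hv => hA0 v hv
  obtain ⟨μ, hμ, hgμ⟩ : ∃ μ > 0, ∀ v ∈ A, μ ≤ ‖g v‖ := by
    rcases A.eq_empty_or_nonempty with hAe | hAn
    · exact ⟨1, one_pos, by simp [hAe]⟩
    · obtain ⟨v, hv, hmin⟩ := hAc.exists_isMinOn hAn hgA.norm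
      exact ⟨‖g v‖, norm_pos_iff.2 (hne v (hA0 v hv)), fun w hw => hmin hw⟩
  set η : ℝ := μ / (2 * ℓ + 1) with hη
  have hηpos : 0 < η := by positivity
  obtain ⟨δ, hδ, hunif⟩ := Metric.uniformContinuousOn_iff.1
    (hAc.uniformContinuousOn_of_continuous hgA) η hηpos
  -- The sign cochains of the components of `g`; `t` decides where a component vanishes.
  obtain ⟨t, ht⟩ := exists_antisymmetric_pred (EuclideanSpace ℝ (Fin k))
  let s : Fin ℓ → EuclideanSpace ℝ (Fin k) → ZMod 2 := fun j x =>
    if 0 < g x j ∨ (g x j = 0 ∧ t x) then 1 else 0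
  have hs : ∀ j, ∀ x ≠ 0, s j (-x) = s j x + 1 := by
    intro j x hx
    have h1 : g (-x) j = -g x j := by rw [hodd x hx]; rfl
    simp only [s, h1, ht x hx]
    rcases lt_trichotomy (g x j) 0 with h | h | h
    · simp [h, h.ne, h.le]
    · by_cases hx : t x <;> simp [h, hx]; rfl
    · simp [h, h.ne', h.not_gt]; rfl
  have hsne : ∀ j x y, s j x ≠ s j y → |g x j| ≤ |g x j - g y j| := by
    intro j x y h
    by_cases hx : 0 ≤ g x j <;> by_cases hy : 0 ≤ g y j
    · rcases hx.eq_or_lt with hx' | hx'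
      · rw [← hx']; simp
      · rcases hy.eq_or_lt with hy' | hy'
        · rw [← hy']; simp
        · simp [s, hx', hy'] at h
    · rw [abs_of_nonneg hx, abs_of_nonneg (by linarith)]; linarith
    · rw [abs_of_nonpos (by linarith), abs_of_nonpos (by linarith)]; linarith
    · have hx' : ¬ 0 < g x j := by linarith
      have hy' : ¬ 0 < g y j := by linarith
      have hx'' : g x j ≠ 0 := by linarith
      have hy'' : g y j ≠ 0 := by linarith
      simp [s, hx', hy', hx'', hy''] at h
  let e : ℕ → EuclideanSpace ℝ (Fin k) := fun i =>
    if h : i < k then EuclideanSpace.single ⟨i, h⟩ 1 else 0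
  have he : ∀ i : Fin k, e i = EuclideanSpace.single i 1 := by
    intro i; simp [e]
  have hsupp : ∀ N i : ℕ, i < k → fineHemisphere e N i ∈ Finsupp.supported (ZMod 2) (ZMod 2)
      {l : List (EuclideanSpace ℝ (Fin k)) | l.length = i + 1 ∧ (∀ v ∈ l, v ∈ A) ∧
        ∀ v ∈ l, ∀ w ∈ l, dist v w ≤ (1 - 1 / ((i + 1 : ℕ) : ℝ)) ^ N * 2} := by
    intro N i hi
    have h1 := iterate_sd_mem_supported (m := i + 1) (by omega)
      (𝒦 := {K | ∃ ε : Fin k → ℝ, (∀ j, |ε j| ≤ 1) ∧ K = slab ε})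
      (by rintro _ ⟨ε, _, rfl⟩; exact convex_slab ε) zero_le_two (c := hemisphere e i)
      (Finsupp.supported_mono (by
        rintro l ⟨h2, ε, hε, h3⟩
        refine ⟨h2, ⟨slab ε, ⟨ε, hε, rfl⟩, fun v hv => (h3 v hv).1⟩, fun v hv w hw => ?_⟩
        have hv1 := (h3 v hv).1.1
        have hw1 := (h3 w hw).1.1
        exact (dist_le_norm_add_norm v w).trans (by linarith)) (hemisphere_mem_supported he hi)) N
    refine Finsupp.supported_mono ?_ h1
    rintro l ⟨h2, ⟨_, ⟨ε, hε, rfl⟩, h3⟩, h4⟩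
    exact ⟨h2, fun v hv => hsA ε hε (h3 v hv), h4⟩
  obtain ⟨N, hN⟩ : ∃ N : ℕ, (1 - 1 / ((ℓ + 1 : ℕ) : ℝ)) ^ N * 2 < δ := by
    have h1 : (0 : ℝ) < ((ℓ + 1 : ℕ) : ℝ) := by positivity
    have h2 : 0 ≤ 1 - 1 / ((ℓ + 1 : ℕ) : ℝ) :=
      sub_nonneg.2 (div_le_one_of_le₀ (by norm_cast; omega) h1.le)
    have h3 : 1 - 1 / ((ℓ + 1 : ℕ) : ℝ) < 1 := sub_lt_self _ (by positivity)
    obtain ⟨N, hN⟩ := exists_pow_lt_of_lt_one (half_pos hδ) h3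
    exact ⟨N, by linarith⟩
  have hcup : cup (List.ofFn s) (fineHemisphere e N (List.ofFn s).length) = 1 := by
    refine cup_fineHemisphere fun i hi => Finsupp.supported_mono ?_ (hsupp N i ?_)
    · rintro l ⟨h1, h2, -⟩
      refine ⟨by rintro rfl; simp at h1, fun s' hs' v hv => ?_⟩
      obtain ⟨j, rfl⟩ := List.mem_ofFn.1 hs'
      exact hs j v (hA0 v (h2 v hv))
    · rw [List.length_ofFn] at hi; omega
  rw [List.length_ofFn] at hcup
  obtain ⟨l, hl, hcl⟩ : ∃ l ∈ (fineHemisphere e N ℓ).support,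
      cup (List.ofFn s) (Finsupp.single l 1) ≠ 0 := by
    by_contra! h
    have h0 : cup (List.ofFn s) (fineHemisphere e N ℓ) = 0 := by
      conv_lhs => rw [← Finsupp.sum_single (fineHemisphere e N ℓ)]
      rw [Finsupp.sum, map_sum]
      refine Finset.sum_eq_zero fun x hx => ?_
      rw [← mul_one (fineHemisphere e N ℓ x), ← smul_eq_mul, ← Finsupp.smul_single, map_smul,
        h x hx, smul_zero]
    rw [hcup] at h0
    exact one_ne_zero h0
  obtain ⟨hlen, hlA, hld⟩ := hsupp N ℓ hℓ hl
  obtain ⟨v₀, hv₀⟩ : ∃ v₀, v₀ ∈ l := List.exists_mem_of_ne_nil l (by rintro rfl; simp at hlen)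
  have hclose : ∀ v ∈ l, ∀ w ∈ l, ∀ j, |g v j - g w j| ≤ η := by
    intro v hv w hw j
    have h1 := hunif v (hlA v hv) w (hlA w hw) ((hld v hv w hw).trans_lt hN)
    rw [dist_eq_norm] at h1
    exact (PiLp.norm_apply_le (g v - g w) j).trans h1.le
  have hsmall : ∀ j, |g v₀ j| ≤ 2 * η := by
    intro j
    obtain ⟨v, hv, w, hw, hvw⟩ := exists_ne_of_cup_ne_zero hcl (List.mem_ofFn.2 ⟨j, rfl⟩)
    have h1 := (hsne j v w hvw).trans (hclose v hv w hw j)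
    have h2 := hclose v₀ hv₀ v hv j
    have h3 := abs_sub_abs_le_abs_sub (g v₀ j) (g v j)
    linarith
  have hsum : ‖g v₀‖ ≤ ∑ j, |g v₀ j| := by
    have h1 : g v₀ = ∑ j, g v₀ j • EuclideanSpace.single j (1 : ℝ) := by
      ext i
      simp [Finset.sum_apply, Pi.single_apply]
    conv_lhs => rw [h1]
    refine norm_sum_le_of_le _ fun j _ => ?_
    rw [norm_smul]; simp
  have h1 := hgμ v₀ (hlA v₀ hv₀)
  have h2 : ∑ j, |g v₀ j| ≤ ℓ * (2 * η) := by
    refine (Finset.sum_le_sum fun j _ => hsmall j).trans_eq ?_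
    simp
  have h3 : η * (2 * ℓ + 1) = μ := div_mul_cancel₀ _ (by positivity)
  nlinarith

end BorsukUlam

namespace SteklovP

/-! ### Hausdorff measure and maps that do not increase or decrease distances -/

section Hausdorff

variable {X Y : Type*} [MetricSpace X] [MeasurableSpace X] [BorelSpace X]
  [MetricSpace Y] [MeasurableSpace Y] [BorelSpace Y]

theorem euclideanHausdorffMeasure_image_le {f : X → Y} {s : Set X} (hf : LipschitzOnWith 1 f s)
    (d : ℕ) : Measure.euclideanHausdorffMeasure d (f '' s) ≤
      Measure.euclideanHausdorffMeasure d s := by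
  rw [Measure.euclideanHausdorffMeasure_def, Measure.euclideanHausdorffMeasure_def]
  have h := hf.hausdorffMeasure_image_le (d := (d : ℝ)) (by positivity)
  simp only [ENNReal.coe_one, ENNReal.one_rpow, one_mul] at h
  simp only [Measure.smul_apply]
  gcongr

theorem euclideanHausdorffMeasure_le_image {w : X → Y} {s : Set X}
    (hw : ∀ y ∈ s, ∀ y' ∈ s, dist y y' ≤ dist (w y) (w y')) (d : ℕ) :
    Measure.euclideanHausdorffMeasure d s ≤ Measure.euclideanHausdorffMeasure d (w '' s) := by
  rcases s.eq_empty_or_nonempty with rfl | ⟨x₀, -⟩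
  · simp
  have : Nonempty X := ⟨x₀⟩
  have hinj : Set.InjOn w s := fun y hy y' hy' h => by
    have := hw y hy y' hy'
    rw [h, dist_self] at this
    exact dist_le_zero.1 this
  have hinv : Function.invFunOn w s '' (w '' s) = s := hinj.invFunOn_image subset_rfl
  conv_lhs => rw [← hinv]
  refine euclideanHausdorffMeasure_image_le (LipschitzOnWith.of_dist_le_mul ?_) d
  rintro _ ⟨y, hy, rfl⟩ _ ⟨y', hy', rfl⟩
  rw [hinj.leftInvOn_invFunOn hy, hinj.leftInvOn_invFunOn hy']
  simpa using hw y hy y' hy'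

end Hausdorff

/-! ### Coordinate projections and faces of cubes -/

section Coordinates

variable {m : ℕ}

/-- Forgetting the `i`-th coordinate. -/
def dropCoord (i : Fin (m + 1)) (y : EuclideanSpace ℝ (Fin (m + 1))) : EuclideanSpace ℝ (Fin m) :=
  WithLp.toLp 2 fun j => y (i.succAbove j)

/-- Inserting the `i`-th coordinate `c`. -/
def insertCoord (i : Fin (m + 1)) (c : ℝ) (z : EuclideanSpace ℝ (Fin m)) :
    EuclideanSpace ℝ (Fin (m + 1)) :=
  WithLp.toLp 2 (i.insertNth c (fun j => z j))

theorem dist_dropCoord_le (i : Fin (m + 1)) (y y' : EuclideanSpace ℝ (Fin (m + 1))) :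
    dist (dropCoord i y) (dropCoord i y') ≤ dist y y' := by
  rw [EuclideanSpace.dist_eq, EuclideanSpace.dist_eq, i.sum_univ_succAbove]
  refine Real.sqrt_le_sqrt ?_
  simp only [dropCoord]
  exact le_add_of_nonneg_left (sq_nonneg _)

theorem dist_insertCoord (i : Fin (m + 1)) (c : ℝ) (z z' : EuclideanSpace ℝ (Fin m)) :
    dist (insertCoord i c z) (insertCoord i c z') = dist z z' := by
  rw [EuclideanSpace.dist_eq, EuclideanSpace.dist_eq, i.sum_univ_succAbove]
  simp [insertCoord]

theorem volume_box (a : Fin m → ℝ) {R : ℝ} (hR : 0 ≤ R) :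
    volume {z : EuclideanSpace ℝ (Fin m) | ∀ j, |z j - a j| ≤ R} =
      ENNReal.ofReal ((2 * R) ^ m) := by
  have h1 : {z : EuclideanSpace ℝ (Fin m) | ∀ j, |z j - a j| ≤ R} =
      WithLp.ofLp ⁻¹' (Set.Icc (fun j => a j - R) (fun j => a j + R)) := by
    ext z
    simp only [Set.mem_ofPred_eq, Set.mem_preimage, Set.mem_Icc, Pi.le_def, abs_le, ← forall_and]
    refine forall_congr' fun j => ?_
    constructor <;> rintro ⟨h, h'⟩ <;> constructor <;> linarith
  rw [h1, (PiLp.volume_preserving_ofLp (Fin m)).measure_preimage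
    measurableSet_Icc.nullMeasurableSet, Real.volume_Icc_pi]
  have h2 : ∀ j : Fin m, a j + R - (a j - R) = 2 * R := fun j => by ring
  simp only [h2, Finset.prod_const, Finset.card_univ, Fintype.card_fin]
  rw [ENNReal.ofReal_pow (by positivity)]

/-- The faces of the cube with center `x` and side `2 * R`. -/
def cubeFace (x : EuclideanSpace ℝ (Fin (m + 1))) (R : ℝ) (i : Fin (m + 1)) (b : Bool) :
    Set (EuclideanSpace ℝ (Fin (m + 1))) :=
  {w | w i = x i + (if b then R else -R) ∧ ∀ j, |w j - x j| ≤ R}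

theorem euclideanHausdorffMeasure_cubeFace_le (x : EuclideanSpace ℝ (Fin (m + 1))) {R : ℝ}
    (hR : 0 ≤ R) (i : Fin (m + 1)) (b : Bool) :
    Measure.euclideanHausdorffMeasure m (cubeFace x R i b) ≤ ENNReal.ofReal ((2 * R) ^ m) := by
  set c : ℝ := x i + (if b then R else -R)
  have h1 : cubeFace x R i b ⊆ insertCoord i c ''
      {z : EuclideanSpace ℝ (Fin m) | ∀ j, |z j - dropCoord i x j| ≤ R} := by
    rintro w ⟨h1, h2⟩
    refine ⟨dropCoord i w, fun j => h2 _, ?_⟩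
    ext j
    refine i.succAboveCases ?_ (fun j => ?_) j
    · simpa [insertCoord] using h1.symm
    · simp [insertCoord, dropCoord]
  refine (measure_mono h1).trans ?_
  refine (euclideanHausdorffMeasure_image_le (LipschitzOnWith.of_dist_le_mul
    fun z _ z' _ => ?_) m).trans ?_
  · simp [dist_insertCoord]
  · rw [EuclideanSpace.euclideanHausdorffMeasure_eq_volume, volume_box _ hR]

/-- A slab of width `2 * ρ` over a set of the coordinate hyperplane, by Fubini. -/
theorem volume_le_of_dropCoord_mem (i : Fin (m + 1)) (a : ℝ) {ρ : ℝ}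
    {K : Set (EuclideanSpace ℝ (Fin (m + 1)))} (hK : ∀ y ∈ K, |y i - a| ≤ ρ) :
    volume K ≤ ENNReal.ofReal (2 * ρ) * volume (dropCoord i '' K) := by
  let e := MeasurableEquiv.piFinSuccAbove (fun _ : Fin (m + 1) => ℝ) i
  let D : Set (Fin m → ℝ) := WithLp.toLp 2 ⁻¹' (dropCoord i '' K)
  have h1 : K ⊆ WithLp.ofLp ⁻¹' (e ⁻¹' (Set.Icc (a - ρ) (a + ρ) ×ˢ D)) := by
    intro y hy
    refine ⟨?_, y, hy, rfl⟩
    have := abs_le.1 (hK y hy)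
    constructor
    · show a - ρ ≤ y i
      linarith
    · show y i ≤ a + ρ
      linarith
  refine (measure_mono h1).trans_eq ?_
  have h2 := (PiLp.volume_preserving_ofLp (Fin (m + 1))).measure_preimage_equiv
    (f := (MeasurableEquiv.toLp 2 (Fin (m + 1) → ℝ)).symm)
    (e ⁻¹' (Set.Icc (a - ρ) (a + ρ) ×ˢ D))
  have h3 := (volume_preserving_piFinSuccAbove (fun _ : Fin (m + 1) => ℝ) i).measure_preimage_equiv
    (f := e) (Set.Icc (a - ρ) (a + ρ) ×ˢ D)
  have h4 := (PiLp.volume_preserving_toLp (Fin m)).measure_preimage_equiv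
    (f := MeasurableEquiv.toLp 2 (Fin m → ℝ)) (dropCoord i '' K)
  refine h2.trans (h3.trans ?_)
  rw [Measure.volume_eq_prod, Measure.prod_prod, Real.volume_Icc]
  congr 1
  ring_nf

end Coordinates

/-! ### Volume and boundary measure of convex sets -/

section Convex

variable {m : ℕ} {Ω : Set (EuclideanSpace ℝ (Fin (m + 1)))}

theorem exists_supporting_normal (ho : IsOpen Ω) (hc : Convex ℝ Ω)
    {x : EuclideanSpace ℝ (Fin (m + 1))} (hx : x ∈ frontier Ω) :
    ∃ ν : EuclideanSpace ℝ (Fin (m + 1)), ν ≠ 0 ∧ (∀ z ∈ Ω, inner ℝ ν z < inner ℝ ν x) ∧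
      ∀ z ∈ closure Ω, inner ℝ ν z ≤ inner ℝ ν x := by
  have hxΩ : x ∉ Ω := by
    rw [ho.frontier_eq] at hx
    exact hx.2
  obtain ⟨f, hf⟩ := geometric_hahn_banach_open_point hc ho hxΩ
  set ν := (InnerProductSpace.toDual ℝ _).symm f with hν
  have hfν : ∀ z, inner ℝ ν z = f z := fun z => by
    rw [hν, InnerProductSpace.toDual_symm_apply]
  have h1 : ∀ z ∈ Ω, inner ℝ ν z < inner ℝ ν x := fun z hz => by
    rw [hfν, hfν]; exact hf z hz
  refine ⟨ν, ?_, h1, ?_⟩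
  · intro h0
    obtain ⟨z, hz⟩ : Ω.Nonempty := closure_nonempty_iff.1 ⟨x, frontier_subset_closure hx⟩
    have := h1 z hz
    simp [h0] at this
  · intro z hz
    have hcl : IsClosed {z | inner ℝ ν z ≤ inner ℝ ν x} :=
      isClosed_le (by fun_prop) continuous_const
    exact closure_minimal (fun z hz => (h1 z hz).le) hcl hz

theorem exists_mem_frontier_of_exit (ho : IsOpen Ω)
    {y d : EuclideanSpace ℝ (Fin (m + 1))} (hy : y ∈ Ω) {T : ℝ} (hT : 0 ≤ T)
    (hyT : y + T • d ∉ Ω) : ∃ t ∈ Set.Icc 0 T, y + t • d ∈ frontier Ω := by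
  by_contra! h
  have hcont : Continuous fun t : ℝ => y + t • d := by fun_prop
  have hpre : IsPreconnected ((fun t : ℝ => y + t • d) '' Set.Icc 0 T) :=
    isPreconnected_Icc.image _ hcont.continuousOn
  have hnf : ∀ t ∈ Set.Icc 0 T, y + t • d ∉ Ω → y + t • d ∈ (closure Ω)ᶜ := by
    intro t ht hn hcl
    exact h t ht (by rw [ho.frontier_eq]; exact ⟨hcl, hn⟩)
  obtain ⟨z, -, hz1, hz2⟩ := hpre Ω (closure Ω)ᶜ ho isClosed_closure.isOpen_compl
    (by
      rintro _ ⟨t, ht, rfl⟩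
      by_cases hn : y + t • d ∈ Ω
      · exact Or.inl hn
      · exact Or.inr (hnf t ht hn))
    ⟨y, ⟨0, ⟨le_rfl, hT⟩, by simp⟩, hy⟩
    ⟨y + T • d, ⟨T, ⟨hT, le_rfl⟩, rfl⟩, hnf T ⟨hT, le_rfl⟩ hyT⟩
  exact hz2 (subset_closure hz1)

theorem exists_add_smul_mem_cubeFace {x y ν : EuclideanSpace ℝ (Fin (m + 1))} (hν : ν ≠ 0)
    {R : ℝ} (hy : dist y x < R) :
    ∃ t : ℝ, 0 ≤ t ∧ y + t • ν ∈ ⋃ i, ⋃ b, cubeFace x R i b := by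
  have hR : 0 < R := dist_nonneg.trans_lt hy
  obtain ⟨i, hi⟩ : ∃ i, ν i ≠ 0 := by
    by_contra! h
    exact hν (by ext i; simpa using h i)
  let h : ℝ → ℝ := fun t => ‖fun j => y j + t * ν j - x j‖
  have hcoord : ∀ j, |y j - x j| < R := fun j => by
    refine lt_of_le_of_lt ?_ hy
    rw [dist_eq_norm]
    exact PiLp.norm_apply_le (y - x) j
  have h0 : h 0 ≤ R := by
    refine (pi_norm_le_iff_of_nonneg hR.le).2 fun j => ?_
    simpa using (hcoord j).le
  have hT : 0 ≤ 2 * R / |ν i| := by positivity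
  have h1 : R ≤ h (2 * R / |ν i|) := by
    refine le_trans ?_ (norm_le_pi_norm _ i)
    have h2 : |2 * R / |ν i| * ν i| = 2 * R := by
      rw [abs_mul, abs_of_nonneg hT, div_mul_cancel₀ _ (abs_ne_zero.2 hi)]
    have h3 := abs_sub_abs_le_abs_sub (2 * R / |ν i| * ν i) (-(y i - x i))
    rw [h2, abs_neg] at h3
    have h4 : 2 * R / |ν i| * ν i - -(y i - x i) = y i + 2 * R / |ν i| * ν i - x i := by ring
    rw [h4] at h3
    rw [Real.norm_eq_abs]
    linarith [hcoord i]
  have hcont : Continuous h := by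
    refine continuous_norm.comp (continuous_pi fun j => ?_)
    fun_prop
  obtain ⟨t, ht, htR⟩ := intermediate_value_Icc hT hcont.continuousOn ⟨h0, h1⟩
  have hle : ∀ j, |y j + t * ν j - x j| ≤ R := fun j => by
    rw [← htR]
    exact norm_le_pi_norm (fun j => y j + t * ν j - x j) j
  obtain ⟨j, hj⟩ : ∃ j, |y j + t * ν j - x j| = R := by
    by_contra! hlt
    have : h t < R := (pi_norm_lt_iff hR).2 fun j => lt_of_le_of_ne (hle j) (hlt j)
    exact this.ne htR
  refine ⟨t, ht.1, Set.mem_iUnion₂.2 ?_⟩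
  rcases (abs_eq hR.le).1 hj with hj | hj
  · refine ⟨j, true, ?_, by simpa using hle⟩
    simp; linarith
  · refine ⟨j, false, ?_, by simpa using hle⟩
    simp; linarith

/-- The boundary of a convex set has at most the measure of the surface of a cube in each ball:
moving each boundary point along an outer normal until it meets the cube does not decrease
distances. -/
theorem frontier_inter_ball_le (ho : IsOpen Ω) (hc : Convex ℝ Ω)
    (x : EuclideanSpace ℝ (Fin (m + 1))) {R : ℝ} (hR : 0 < R) :
    Measure.euclideanHausdorffMeasure m (frontier Ω ∩ Metric.ball x R) ≤
      ENNReal.ofReal (2 * (m + 1) * (2 * R) ^ m) := by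
  have h1 : ∀ y : EuclideanSpace ℝ (Fin (m + 1)), ∃ w, y ∈ frontier Ω ∩ Metric.ball x R →
      w ∈ (⋃ i, ⋃ b, cubeFace x R i b) ∧ ∃ ν, ∃ t : ℝ, 0 ≤ t ∧ w = y + t • ν ∧
        ∀ z ∈ closure Ω, inner ℝ ν z ≤ inner ℝ ν y := by
    intro y
    by_cases hy : y ∈ frontier Ω ∩ Metric.ball x R
    · obtain ⟨ν, hν, -, hν'⟩ := exists_supporting_normal ho hc hy.1
      obtain ⟨t, ht, htm⟩ := exists_add_smul_mem_cubeFace hν hy.2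
      exact ⟨y + t • ν, fun _ => ⟨htm, ν, t, ht, rfl, hν'⟩⟩
    · exact ⟨y, fun h => absurd h hy⟩
  choose w hw using h1
  refine (euclideanHausdorffMeasure_le_image (w := w) ?_ m).trans ?_
  · intro y hy y' hy'
    obtain ⟨-, ν, t, ht, hwy, hν⟩ := hw y hy
    obtain ⟨-, ν', t', ht', hwy', hν'⟩ := hw y' hy'
    have h2 := hν y' (frontier_subset_closure hy'.1)
    have h3 := hν' y (frontier_subset_closure hy.1)
    have h4 : 0 ≤ inner ℝ (y - y') (t • ν - t' • ν') := by
      have h5 : inner ℝ (y - y') (t • ν - t' • ν') =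
          t * (inner ℝ ν y - inner ℝ ν y') + t' * (inner ℝ ν' y' - inner ℝ ν' y) := by
        simp only [inner_sub_left, inner_sub_right, real_inner_smul_right,
          real_inner_comm ν, real_inner_comm ν']
        ring
      rw [h5]
      have := mul_nonneg ht (sub_nonneg.2 h2)
      have := mul_nonneg ht' (sub_nonneg.2 h3)
      linarith
    rw [dist_eq_norm, dist_eq_norm, hwy, hwy']
    have h6 : y + t • ν - (y' + t' • ν') = (y - y') + (t • ν - t' • ν') := by abel
    rw [h6]
    refine le_of_sq_le_sq ?_ (norm_nonneg _)
    rw [norm_add_sq_real]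
    have := sq_nonneg ‖t • ν - t' • ν'‖
    linarith
  · have h2 : w '' (frontier Ω ∩ Metric.ball x R) ⊆ ⋃ i, ⋃ b, cubeFace x R i b := by
      rintro _ ⟨y, hy, rfl⟩
      exact (hw y hy).1
    refine (measure_mono h2).trans ?_
    refine (measure_iUnion_fintype_le _ _).trans ?_
    refine (Finset.sum_le_sum fun i _ => measure_iUnion_fintype_le _ _).trans ?_
    refine (Finset.sum_le_sum fun i _ => Finset.sum_le_sum fun b _ =>
      euclideanHausdorffMeasure_cubeFace_le x hR.le i b).trans_eq ?_
    simp only [Finset.sum_const, Finset.card_univ, Fintype.card_fin, Fintype.card_bool,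
      nsmul_eq_mul]
    rw [ENNReal.ofReal_mul (by positivity), ← mul_assoc]
    congr 1
    rw [← ENNReal.ofReal_natCast, ← ENNReal.ofReal_natCast, ← ENNReal.ofReal_mul (by positivity)]
    congr 1
    push_cast
    ring

/-- Project along the coordinate axis on which the normal at `x` has its largest component: there,
the projection of the boundary near `x` covers that of the interior. -/
theorem volume_inter_ball_le (ho : IsOpen Ω) (hc : Convex ℝ Ω)
    {x : EuclideanSpace ℝ (Fin (m + 1))} (hx : x ∈ frontier Ω) {ρ : ℝ} (hρ : 0 < ρ) :
    volume (Ω ∩ Metric.ball x ρ) ≤ ENNReal.ofReal (2 * ρ) *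
      Measure.euclideanHausdorffMeasure m (frontier Ω ∩ Metric.ball x ((m + 2) * ρ)) := by
  obtain ⟨ν, hν, hν', -⟩ := exists_supporting_normal ho hc hx
  obtain ⟨i, hi⟩ := Finite.exists_max fun i => |ν i|
  have hi0 : 0 < |ν i| := by
    by_contra! h
    refine hν (PiLp.ext fun j => ?_)
    simpa using (hi j).trans h
  have hcoord : ∀ y ∈ Ω ∩ Metric.ball x ρ, ∀ j, |y j - x j| ≤ ρ := fun y hy j => by
    refine le_trans ?_ (Metric.mem_ball.1 hy.2).le
    rw [dist_eq_norm]
    exact PiLp.norm_apply_le (y - x) j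
  refine (volume_le_of_dropCoord_mem i (x i) fun y hy => hcoord y hy i).trans ?_
  gcongr
  rw [← EuclideanSpace.euclideanHausdorffMeasure_eq_volume]
  -- The points of `Ω` near `x` leave `Ω` in the `i`-th coordinate direction after at most
  -- `(m + 1) * ρ`, since the `i`-th component of the normal is the largest one.
  obtain ⟨σ, hσ1, hσν⟩ : ∃ σ : ℝ, |σ| ≤ 1 ∧ ν i * σ = |ν i| := by
    rcases le_total 0 (ν i) with h | h
    · exact ⟨1, by simp, by rw [abs_of_nonneg h, mul_one]⟩
    · exact ⟨-1, by simp, by rw [abs_of_nonpos h]; ring⟩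
  set d : EuclideanSpace ℝ (Fin (m + 1)) := EuclideanSpace.single i σ with hd
  have hdn : ‖d‖ ≤ 1 := by simpa [hd] using hσ1
  have h1 : dropCoord i '' (Ω ∩ Metric.ball x ρ) ⊆
      dropCoord i '' (frontier Ω ∩ Metric.ball x ((m + 2) * ρ)) := by
    rintro _ ⟨y, hy, rfl⟩
    have hexit : y + ((m + 1) * ρ) • d ∉ Ω := by
      intro hmem
      have h2 := hν' _ hmem
      have h3 : inner ℝ ν d = |ν i| := by
        rw [hd, ← hσν, EuclideanSpace.inner_single_right]
        simp [mul_comm]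
      rw [inner_add_right, real_inner_smul_right, h3] at h2
      have h4 : inner ℝ ν x - inner ℝ ν y ≤ (m + 1) * ρ * |ν i| := by
        rw [← inner_sub_right, PiLp.inner_apply]
        refine (Finset.sum_le_sum (g := fun _ => ρ * |ν i|) fun j _ => ?_).trans_eq ?_
        · refine (le_abs_self _).trans ?_
          have h5 := hcoord y hy j
          rw [abs_sub_comm] at h5
          have : |inner ℝ (ν j) ((x - y) j)| = |x j - y j| * |ν j| := by
            rw [← abs_mul]; rfl
          rw [this]
          exact mul_le_mul h5 (hi j) (abs_nonneg _) hρ.le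
        · simp; ring
      linarith
    obtain ⟨t, ht, hf⟩ := exists_mem_frontier_of_exit ho hy.1 (by positivity) hexit
    refine ⟨y + t • d, ⟨hf, ?_⟩, ?_⟩
    · rw [Metric.mem_ball]
      have h2 : dist (y + t • d) y ≤ (m + 1) * ρ := by
        rw [dist_eq_norm, add_sub_cancel_left, norm_smul, Real.norm_of_nonneg ht.1]
        exact (mul_le_of_le_one_right ht.1 hdn).trans ht.2
      have h3 := dist_triangle (y + t • d) y x
      have h4 := Metric.mem_ball.1 hy.2
      linarith
    · ext j
      simp [dropCoord, hd]
  refine (measure_mono h1).trans (euclideanHausdorffMeasure_image_le ?_ m)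
  exact LipschitzOnWith.of_dist_le_mul fun z _ z' _ => by simpa using dist_dropCoord_le i z z'

/-- The homothety with center `x` and ratio `1 / N` maps a convex set with `x` in its closure into
itself. -/
theorem volume_inter_ball_le_scaled (ho : IsOpen Ω) (hc : Convex ℝ Ω)
    {x : EuclideanSpace ℝ (Fin (m + 1))} (hx : x ∈ frontier Ω) (r : ℝ) {N : ℝ} (hN : 1 ≤ N) :
    volume (Ω ∩ Metric.ball x r) ≤
      ENNReal.ofReal (N ^ (m + 1)) * volume (Ω ∩ Metric.ball x (r / N)) := by
  have hN0 : 0 < N := by linarith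
  have h1 : AffineMap.homothety x N⁻¹ '' (Ω ∩ Metric.ball x r) ⊆
      Ω ∩ Metric.ball x (r / N) := by
    rintro _ ⟨y, ⟨hy, hyr⟩, rfl⟩
    have h2 : AffineMap.homothety x N⁻¹ y = (1 - N⁻¹) • x + N⁻¹ • y := by
      simp only [AffineMap.homothety_apply, vsub_eq_sub, vadd_eq_add, smul_sub, sub_smul, one_smul]
      abel
    constructor
    · rw [h2, ← ho.interior_eq]
      refine hc.combo_closure_interior_mem_interior (frontier_subset_closure hx)
        (by rwa [ho.interior_eq]) (sub_nonneg.2 (inv_le_one_of_one_le₀ hN)) (by positivity)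
        (by ring)
    · rw [Metric.mem_ball, dist_homothety_center, Real.norm_of_nonneg (by positivity),
        div_eq_inv_mul, dist_comm]
      exact mul_lt_mul_of_pos_left hyr (by positivity)
  have h3 := measure_mono (μ := volume) h1
  rw [Measure.addHaar_image_homothety, finrank_euclideanSpace_fin, abs_of_nonneg (by positivity)]
    at h3
  calc volume (Ω ∩ Metric.ball x r)
      = ENNReal.ofReal (N ^ (m + 1)) *
          (ENNReal.ofReal (N⁻¹ ^ (m + 1)) * volume (Ω ∩ Metric.ball x r)) := by
        rw [← mul_assoc, ← ENNReal.ofReal_mul (by positivity), ← mul_pow,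
          mul_inv_cancel₀ hN0.ne', one_pow, ENNReal.ofReal_one, one_mul]
    _ ≤ _ := by gcongr

/-- The volume of a convex set in a ball about a boundary point is controlled by the radius times
the boundary measure in the concentric ball of half the radius. -/
theorem volume_inter_ball_le_half (ho : IsOpen Ω) (hc : Convex ℝ Ω)
    {x : EuclideanSpace ℝ (Fin (m + 1))} (hx : x ∈ frontier Ω) {r : ℝ} (hr : 0 < r) :
    volume (Ω ∩ Metric.ball x r) ≤ ENNReal.ofReal ((2 * (m + 2)) ^ (m + 1) * r) *
      Measure.euclideanHausdorffMeasure m (frontier Ω ∩ Metric.ball x (r / 2)) := by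
  have hm : (0 : ℝ) ≤ m := by positivity
  refine (volume_inter_ball_le_scaled ho hc hx r (N := 2 * (m + 2)) (by linarith)).trans ?_
  have h1 := volume_inter_ball_le ho hc hx (ρ := r / (2 * (m + 2))) (by positivity)
  have h2 : ((m : ℝ) + 2) * (r / (2 * (m + 2))) = r / 2 := by field_simp
  rw [h2] at h1
  rw [ENNReal.ofReal_mul (by positivity), mul_assoc]
  gcongr
  refine h1.trans ?_
  gcongr
  rw [mul_div_assoc', div_le_iff₀ (by positivity)]
  nlinarith

theorem volume_inter_ball_pos (ho : IsOpen Ω) {x : EuclideanSpace ℝ (Fin (m + 1))}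
    (hx : x ∈ frontier Ω) {r : ℝ} (hr : 0 < r) : 0 < volume (Ω ∩ Metric.ball x r) := by
  refine (ho.inter Metric.isOpen_ball).measure_pos volume ?_
  obtain ⟨y, hy, hyx⟩ := Metric.mem_closure_iff.1 (frontier_subset_closure hx) r hr
  exact ⟨y, hy, by rwa [Metric.mem_ball, dist_comm]⟩

end Convex

/-! ### Smooth functions in the Sobolev space -/

section Smooth

variable {n : ℕ} {p : ℝ≥0∞} {Ω : Set (EuclideanSpace ℝ (Fin n))}

theorem continuous_gradient {f : EuclideanSpace ℝ (Fin n) → ℝ} (hf : ContDiff ℝ ∞ f) :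
    Continuous (gradient f) :=
  (InnerProductSpace.toDual ℝ _).symm.continuous.comp (hf.continuous_fderiv (by simp))

theorem hasCompactSupport_gradient {f : EuclideanSpace ℝ (Fin n) → ℝ}
    (hc : HasCompactSupport f) : HasCompactSupport (gradient f) :=
  (hc.fderiv ℝ).comp_left (map_zero (InnerProductSpace.toDual ℝ _).symm)

theorem gradient_of_notMem_tsupport {f : EuclideanSpace ℝ (Fin n) → ℝ}
    {x : EuclideanSpace ℝ (Fin n)} (hx : x ∉ tsupport f) : gradient f x = 0 := by
  rw [gradient, fderiv_of_notMem_tsupport ℝ hx, map_zero]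

theorem isWeakGradient_gradient {f : EuclideanSpace ℝ (Fin n) → ℝ} (hf : ContDiff ℝ ∞ f) :
    IsWeakGradient Ω f (gradient f) := by
  intro φ hφ hcφ hs v
  have hnot : ∀ x ∉ Ω, x ∉ tsupport φ := fun x hx h => hx (hs h)
  have hdf : Continuous fun x => fderiv ℝ f x v :=
    (hf.continuous_fderiv (by simp)).clm_apply continuous_const
  have hdφ : Continuous fun x => fderiv ℝ φ x v :=
    (hφ.continuous_fderiv (by simp)).clm_apply continuous_const
  rw [setIntegral_eq_integral_of_forall_compl_eq_zero fun x hx => by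
      rw [fderiv_of_notMem_tsupport ℝ (hnot x hx)]; simp,
    setIntegral_eq_integral_of_forall_compl_eq_zero fun x hx => by
      rw [image_eq_zero_of_notMem_tsupport (hnot x hx), zero_mul],
    integral_mul_fderiv_eq_neg_fderiv_mul_of_integrable
      ((hdf.mul hφ.continuous).integrable_of_hasCompactSupport hcφ.mul_left)
      ((hf.continuous.mul hdφ).integrable_of_hasCompactSupport (hcφ.fderiv_apply ℝ v).mul_left)
      ((hf.continuous.mul hφ.continuous).integrable_of_hasCompactSupport hcφ.mul_left)
      (fun x _ => (hf.differentiable (by simp)) x) (fun x _ => (hφ.differentiable (by simp)) x)]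
  simp_rw [inner_gradient_left, mul_comm]

theorem memLp_of_contDiff {f : EuclideanSpace ℝ (Fin n) → ℝ} (hf : ContDiff ℝ ∞ f)
    (hc : HasCompactSupport f) : MemLp f p (volume.restrict Ω) :=
  hf.continuous.memLp_of_hasCompactSupport hc

theorem memLp_gradient {f : EuclideanSpace ℝ (Fin n) → ℝ} (hf : ContDiff ℝ ∞ f)
    (hc : HasCompactSupport f) : MemLp (gradient f) p (volume.restrict Ω) :=
  (continuous_gradient hf).memLp_of_hasCompactSupport (hasCompactSupport_gradient hc)

/-- The restriction to `Ω` of a smooth function with compact support, as an element of the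
Sobolev space. -/
noncomputable def ofSmooth (p : ℝ≥0∞) [Fact (1 ≤ p)] (Ω : Set (EuclideanSpace ℝ (Fin n)))
    (f : EuclideanSpace ℝ (Fin n) → ℝ) (hf : ContDiff ℝ ∞ f) (hc : HasCompactSupport f) :
    W1p p Ω :=
  ⟨((memLp_of_contDiff hf hc).toLp f, (memLp_gradient hf hc).toLp (gradient f)), by
    intro φ hφ hcφ hs v
    have h := isWeakGradient_gradient (Ω := Ω) hf φ hφ hcφ hs v
    have h1 := (memLp_of_contDiff (p := p) (Ω := Ω) hf hc).coeFn_toLp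
    have h2 := (memLp_gradient (p := p) (Ω := Ω) hf hc).coeFn_toLp
    refine (integral_congr_ae (h1.mono fun x hx => ?_)).trans (h.trans
      (congrArg Neg.neg (integral_congr_ae (h2.mono fun x hx => ?_)).symm))
    · exact congrArg (· * fderiv ℝ φ x v) hx
    · exact congrArg (fun w => φ x * inner ℝ w v) hx⟩

/-- At points that `Ω` meets in positive measure at every scale, the limit of means that defines
the trace exists and is the value of the function. -/
theorem trace_ofSmooth [Fact (1 ≤ p)] {f : EuclideanSpace ℝ (Fin n) → ℝ} (hf : ContDiff ℝ ∞ f)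
    (hc : HasCompactSupport f) {x : EuclideanSpace ℝ (Fin n)}
    (hx : ∀ r > 0, volume (Ω ∩ Metric.ball x r) ≠ 0) : trace (ofSmooth p Ω f hf hc) x = f x := by
  refine Tendsto.limUnder_eq ?_
  have h1 : ∀ r, ⨍ y in Ω ∩ Metric.ball x r, (ofSmooth p Ω f hf hc).1.1 y =
      ⨍ y in Ω ∩ Metric.ball x r, f y := by
    intro r
    have h2 : (ofSmooth p Ω f hf hc).1.1 =ᵐ[volume.restrict (Ω ∩ Metric.ball x r)] f :=
      ae_mono (Measure.restrict_mono Set.inter_subset_left le_rfl)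
        (memLp_of_contDiff (p := p) (Ω := Ω) hf hc).coeFn_toLp
    exact average_congr h2
  simp_rw [h1]
  rw [Metric.tendsto_nhds]
  intro ε hε
  obtain ⟨δ, hδ, hδf⟩ := Metric.continuous_iff.1 hf.continuous x (ε / 2) (half_pos hε)
  filter_upwards [Ioo_mem_nhdsGT hδ] with r hr
  have h3 : ⨍ y in Ω ∩ Metric.ball x r, f y ∈ Metric.closedBall (f x) (ε / 2) := by
    refine (convex_closedBall _ _).set_average_mem Metric.isClosed_closedBall (hx r hr.1) ?_ ?_ ?_
    · exact ((measure_mono Set.inter_subset_right).trans_lt measure_ball_lt_top).ne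
    · refine ae_restrict_of_ae_restrict_of_subset Set.inter_subset_right ?_
      filter_upwards [ae_restrict_mem measurableSet_ball] with y hy
      exact (hδf y ((Metric.mem_ball.1 hy).trans hr.2)).le
    · exact (hf.continuous.integrable_of_hasCompactSupport hc).integrableOn
  exact (Metric.mem_closedBall.1 h3).trans_lt (half_lt_self hε)

theorem lintegral_gradient_ofSmooth [Fact (1 ≤ p)]
    {f : EuclideanSpace ℝ (Fin n) → ℝ} (hf : ContDiff ℝ ∞ f)
    (hc : HasCompactSupport f) :
    ∫⁻ x in Ω, ‖(ofSmooth p Ω f hf hc).1.2 x‖ₑ ^ p.toReal =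
      ∫⁻ x in Ω, ‖gradient f x‖ₑ ^ p.toReal :=
  lintegral_congr_ae ((memLp_gradient (p := p) (Ω := Ω) hf hc).coeFn_toLp.mono fun x hx => by
    exact congrArg (fun w => ‖w‖ₑ ^ p.toReal) hx)

theorem boundaryIntegral_ofSmooth [Fact (1 ≤ p)]
    (hΩ : ∀ x ∈ frontier Ω, ∀ r > 0, volume (Ω ∩ Metric.ball x r) ≠ 0)
    {f : EuclideanSpace ℝ (Fin n) → ℝ} (hf : ContDiff ℝ ∞ f) (hc : HasCompactSupport f) :
    boundaryIntegral (ofSmooth p Ω f hf hc) = ∫⁻ x, ‖f x‖ₑ ^ p.toReal ∂(surfaceMeasure Ω) :=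
  setLIntegral_congr_fun isClosed_frontier.measurableSet fun x hx => by
    simp only [trace_ofSmooth hf hc (hΩ x hx)]

end Smooth

/-! ### The span of functions with disjoint supports -/

section Span

variable {n k : ℕ} {Ω : Set (EuclideanSpace ℝ (Fin n))}

theorem enorm_sum_rpow {V : Type*} [NormedAddCommGroup V] {a : Fin k → V}
    (ha : ∀ i j, a i ≠ 0 → a j ≠ 0 → i = j) {q : ℝ} (hq : 0 < q) :
    ‖∑ i, a i‖ₑ ^ q = ∑ i, ‖a i‖ₑ ^ q := by
  by_cases h : ∃ i, a i ≠ 0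
  · obtain ⟨i, hi⟩ := h
    have h0 : ∀ j, j ≠ i → a j = 0 := fun j hj => by
      by_contra h
      exact hj (ha j i h hi)
    rw [Fintype.sum_eq_single i h0, Fintype.sum_eq_single i fun j hj => by
      rw [h0 j hj, enorm_zero, ENNReal.zero_rpow_of_pos hq]]
  · push Not at h
    simp [h, hq]

/-- The linear combination of the functions `u i` with coefficients `c i`. -/
def combo (u : Fin k → EuclideanSpace ℝ (Fin n) → ℝ) (c : Fin k → ℝ)
    (x : EuclideanSpace ℝ (Fin n)) : ℝ := ∑ i, c i * u i x

variable {u : Fin k → EuclideanSpace ℝ (Fin n) → ℝ}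

theorem contDiff_combo (hu : ∀ i, ContDiff ℝ ∞ (u i)) (c : Fin k → ℝ) :
    ContDiff ℝ ∞ (combo u c) :=
  ContDiff.sum fun i _ => contDiff_const.mul (hu i)

theorem hasCompactSupport_combo (hc : ∀ i, HasCompactSupport (u i)) (c : Fin k → ℝ) :
    HasCompactSupport (combo u c) := by
  refine HasCompactSupport.intro (isCompact_iUnion fun i => hc i) fun x hx => ?_
  refine Finset.sum_eq_zero fun i _ => ?_
  rw [image_eq_zero_of_notMem_tsupport fun h => hx (Set.mem_iUnion.2 ⟨i, h⟩), mul_zero]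

theorem gradient_combo (hu : ∀ i, ContDiff ℝ ∞ (u i)) (c : Fin k → ℝ)
    (x : EuclideanSpace ℝ (Fin n)) :
    gradient (combo u c) x = ∑ i, c i • gradient (u i) x := by
  have h1 : ∀ i, DifferentiableAt ℝ (u i) x := fun i => (hu i).differentiable (by simp) x
  have h2 : fderiv ℝ (combo u c) x = ∑ i, c i • fderiv ℝ (u i) x := by
    unfold combo
    rw [fderiv_fun_sum fun i _ => (h1 i).const_mul (c i)]
    exact Finset.sum_congr rfl fun i _ => fderiv_const_mul (h1 i) (c i)
  simp only [gradient, h2, map_sum, map_smul]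

/-- The span of `k` smooth functions in the Sobolev space, as the range of a linear map. -/
noncomputable def spanMap (p : ℝ≥0∞) [Fact (1 ≤ p)] (Ω : Set (EuclideanSpace ℝ (Fin n)))
    (hu : ∀ i, ContDiff ℝ ∞ (u i)) (hc : ∀ i, HasCompactSupport (u i)) :
    (Fin k → ℝ) →ₗ[ℝ] W1p p Ω where
  toFun c := ofSmooth p Ω (combo u c) (contDiff_combo hu c) (hasCompactSupport_combo hc c)
  map_add' c d := by
    refine Subtype.ext (Prod.ext ?_ ?_)
    · refine (MemLp.toLp_congr
        (memLp_of_contDiff (contDiff_combo hu _) (hasCompactSupport_combo hc _))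
        ((memLp_of_contDiff (contDiff_combo hu c)
        (hasCompactSupport_combo hc c)).add (memLp_of_contDiff (contDiff_combo hu d)
        (hasCompactSupport_combo hc d))) (ae_of_all _ fun x => ?_))
      simp [combo, add_mul, Finset.sum_add_distrib]
    · refine (MemLp.toLp_congr
        (memLp_gradient (contDiff_combo hu _) (hasCompactSupport_combo hc _))
        ((memLp_gradient (contDiff_combo hu c)
        (hasCompactSupport_combo hc c)).add (memLp_gradient (contDiff_combo hu d)
        (hasCompactSupport_combo hc d))) (ae_of_all _ fun x => ?_))
      simp [gradient_combo hu, add_smul, Finset.sum_add_distrib]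
  map_smul' a c := by
    refine Subtype.ext (Prod.ext ?_ ?_)
    · refine (MemLp.toLp_congr
        (memLp_of_contDiff (contDiff_combo hu _) (hasCompactSupport_combo hc _))
        ((memLp_of_contDiff (contDiff_combo hu c)
        (hasCompactSupport_combo hc c)).const_smul a) (ae_of_all _ fun x => ?_))
      simp [combo, Finset.mul_sum, mul_assoc]
    · refine (MemLp.toLp_congr
        (memLp_gradient (contDiff_combo hu _) (hasCompactSupport_combo hc _))
        ((memLp_gradient (contDiff_combo hu c)
        (hasCompactSupport_combo hc c)).const_smul a) (ae_of_all _ fun x => ?_))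
      simp [gradient_combo hu, Finset.smul_sum, mul_smul]

/-- A set that contains a linearly embedded punctured `k`-space has genus at least `k`. -/
theorem le_genus_image {W : Type*} [AddCommGroup W] [Module ℝ W] [TopologicalSpace W]
    {T : (Fin k → ℝ) →ₗ[ℝ] W} (hT : Continuous T) : (k : ℕ∞) ≤ genus (T '' {0}ᶜ) := by
  refine le_iInf₂ fun ℓ hℓ => ?_
  obtain ⟨f, hf, hodd, hne⟩ := hℓ
  by_contra! hlt
  have hmem : ∀ x : EuclideanSpace ℝ (Fin k), x ≠ 0 → T (WithLp.ofLp x) ∈ T '' {0}ᶜ := by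
    refine fun x hx => ⟨_, fun h => hx ?_, rfl⟩
    exact (WithLp.ofLp_eq_zero 2).1 h
  obtain ⟨x, hx, hfx⟩ := BorsukUlam.exists_eq_zero_of_odd (by exact_mod_cast hlt)
    (g := fun x => f (T (WithLp.ofLp x)))
    (hf.comp (hT.comp (PiLp.continuous_ofLp 2 _)).continuousOn hmem) fun x hx => by
      simpa using hodd _ (hmem x hx)
  exact hne _ (hmem x hx) hfx

/-- Smooth functions with disjoint supports whose individual Rayleigh quotients are at most `lam`
bound the eigenvalue, since the quotient of a linear combination is a weighted mean of those of
its terms. -/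
theorem steklovEigenvalue_le {p : ℝ≥0∞} [Fact (1 ≤ p)] (hp : p ≠ ⊤)
    (hΩ : ∀ x ∈ frontier Ω, ∀ r > 0, volume (Ω ∩ Metric.ball x r) ≠ 0)
    (hu : ∀ i, ContDiff ℝ ∞ (u i)) (hc : ∀ i, HasCompactSupport (u i))
    (hdisj : ∀ i j, i ≠ j → Disjoint (tsupport (u i)) (tsupport (u j)))
    (hB0 : ∀ i, ∫⁻ x, ‖u i x‖ₑ ^ p.toReal ∂(surfaceMeasure Ω) ≠ 0)
    (hB : ∀ i, ∫⁻ x, ‖u i x‖ₑ ^ p.toReal ∂(surfaceMeasure Ω) ≠ ⊤)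
    {lam : ℝ≥0∞} (hA : ∀ i, ∫⁻ x in Ω, ‖gradient (u i) x‖ₑ ^ p.toReal ≤
      lam * ∫⁻ x, ‖u i x‖ₑ ^ p.toReal ∂(surfaceMeasure Ω)) :
    steklovEigenvalue p Ω k ≤ lam := by
  set q := p.toReal with hq
  have hq0 : 0 < q := ENNReal.toReal_pos (zero_lt_one.trans_le Fact.out).ne' hp
  set B : Fin k → ℝ≥0∞ := fun i => ∫⁻ x, ‖u i x‖ₑ ^ q ∂(surfaceMeasure Ω) with hBdef
  set T := spanMap p Ω hu hc with hT
  have hTc : Continuous T := T.continuous_of_finiteDimensional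
  have hb : ∀ c, boundaryIntegral (T c) = ∑ i, ‖c i‖ₑ ^ q * B i := by
    intro c
    rw [hT]
    refine (boundaryIntegral_ofSmooth hΩ (contDiff_combo hu c)
      (hasCompactSupport_combo hc c)).trans ?_
    have h1 : ∀ x, ‖combo u c x‖ₑ ^ q = ∑ i, ‖c i‖ₑ ^ q * ‖u i x‖ₑ ^ q := by
      intro x
      refine (enorm_sum_rpow (fun i j hi hj => ?_) hq0).trans
        (Finset.sum_congr rfl fun i _ => ?_)
      · by_contra hij
        exact Set.disjoint_left.1 (hdisj i j hij)
          (subset_tsupport _ (right_ne_zero_of_mul hi))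
          (subset_tsupport _ (right_ne_zero_of_mul hj))
      · rw [enorm_mul, ENNReal.mul_rpow_of_nonneg _ _ hq0.le]
    rw [← hq]
    simp_rw [h1]
    rw [lintegral_finsetSum _ fun i _ =>
      (((hu i).continuous.enorm.measurable.pow_const q).const_mul _)]
    refine Finset.sum_congr rfl fun i _ => ?_
    rw [lintegral_const_mul _ ((hu i).continuous.enorm.measurable.pow_const q)]
  have ha : ∀ c, ∫⁻ x in Ω, ‖(T c).1.2 x‖ₑ ^ q ≤ lam * ∑ i, ‖c i‖ₑ ^ q * B i := by
    intro c
    rw [hT]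
    refine (lintegral_gradient_ofSmooth (contDiff_combo hu c)
      (hasCompactSupport_combo hc c)).trans_le ?_
    have h1 : ∀ x, ‖gradient (combo u c) x‖ₑ ^ q =
        ∑ i, ‖c i‖ₑ ^ q * ‖gradient (u i) x‖ₑ ^ q := by
      intro x
      rw [gradient_combo hu]
      refine (enorm_sum_rpow (fun i j hi hj => ?_) hq0).trans
        (Finset.sum_congr rfl fun i _ => ?_)
      · by_contra hij
        refine Set.disjoint_left.1 (hdisj i j hij) (?_ : x ∈ _) ?_
        · by_contra h
          exact hi (by rw [gradient_of_notMem_tsupport h, smul_zero])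
        · by_contra h
          exact hj (by rw [gradient_of_notMem_tsupport h, smul_zero])
      · rw [enorm_smul, ENNReal.mul_rpow_of_nonneg _ _ hq0.le]
    have hm : ∀ i, Measurable fun x => ‖gradient (u i) x‖ₑ ^ q := fun i =>
      (continuous_gradient (hu i)).enorm.measurable.pow_const q
    rw [← hq]
    simp_rw [h1]
    rw [lintegral_finsetSum _ fun i _ => (hm i).const_mul _, Finset.mul_sum]
    refine Finset.sum_le_sum fun i _ => ?_
    rw [lintegral_const_mul _ (hm i), mul_left_comm]
    gcongr
    exact hA i
  have hT0 : ∀ c, c ≠ 0 → T c ≠ 0 := by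
    intro c hc0 h
    have h1 := hb c
    rw [h, ← map_zero T, hb 0] at h1
    simp only [Pi.zero_apply, enorm_zero, ENNReal.zero_rpow_of_pos hq0, zero_mul,
      Finset.sum_const_zero] at h1
    refine hc0 (funext fun i => ?_)
    have h2 := (Finset.sum_eq_zero_iff.1 h1.symm) i (Finset.mem_univ i)
    rcases mul_eq_zero.1 h2 with h3 | h3
    · simpa using (ENNReal.rpow_eq_zero_iff_of_pos hq0).1 h3
    · exact absurd h3 (hB0 i)
  have hF : T '' {0}ᶜ ∈ Gam p Ω k := by
    refine ⟨?_, ?_, ?_, le_genus_image hTc⟩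
    · rintro ⟨c, hc0, h⟩
      exact hT0 c hc0 h
    · -- In coordinates, the normalized functions are those with `∑ |c i| ^ p * B i = 1`.
      have h1 : T '' {0}ᶜ ∩ {w | boundaryIntegral w = 1} =
          T '' {c | ∑ i, |c i| ^ q * (B i).toReal = 1} := by
        have h2 : ∀ c, boundaryIntegral (T c) = 1 ↔ ∑ i, |c i| ^ q * (B i).toReal = 1 := by
          intro c
          have h3 : boundaryIntegral (T c) =
              ENNReal.ofReal (∑ i, |c i| ^ q * (B i).toReal) := by
            rw [hb, ENNReal.ofReal_sum_of_nonneg fun i _ => by positivity]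
            refine Finset.sum_congr rfl fun i _ => ?_
            rw [ENNReal.ofReal_mul (by positivity), ENNReal.ofReal_toReal (hB i),
              ← ENNReal.ofReal_rpow_of_nonneg (abs_nonneg _) hq0.le, Real.enorm_eq_ofReal_abs]
          rw [h3, ENNReal.ofReal_eq_one]
        ext w
        constructor
        · rintro ⟨⟨c, hc0, rfl⟩, hw⟩
          exact ⟨c, (h2 c).1 hw, rfl⟩
        · rintro ⟨c, hc1, rfl⟩
          refine ⟨⟨c, ?_, rfl⟩, (h2 c).2 hc1⟩
          rintro rfl
          simp [hq0.ne'] at hc1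
      rw [h1]
      refine IsCompact.image (Metric.isCompact_of_isClosed_isBounded ?_ ?_) hTc
      · refine isClosed_eq (continuous_finsetSum _ fun i _ => ?_) continuous_const
        exact ((continuous_apply i).abs.rpow_const fun _ => Or.inr hq0.le).mul continuous_const
      · have hBr : ∀ i, 0 < (B i).toReal := fun i => ENNReal.toReal_pos (hB0 i) (hB i)
        refine (Bornology.forall_isBounded_image_eval_iff (s := _)).1 fun i => ?_
        refine (Metric.isBounded_closedBall (x := (0 : ℝ))
          (r := ((B i).toReal⁻¹) ^ q⁻¹)).subset ?_
        rintro _ ⟨c, hc1, rfl⟩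
        have h3 : |c i| ^ q * (B i).toReal ≤ 1 := by
          rw [← show ∑ i, |c i| ^ q * (B i).toReal = 1 from hc1]
          exact Finset.single_le_sum (f := fun i => |c i| ^ q * (B i).toReal)
            (fun i _ => by positivity) (Finset.mem_univ i)
        rw [mem_closedBall_zero_iff, Real.norm_eq_abs]
        show |c i| ≤ _
        rw [Real.le_rpow_inv_iff_of_pos (abs_nonneg _) (inv_nonneg.2 (hBr i).le) hq0,
          ← one_div, le_div_iff₀ (hBr i)]
        exact h3
    · rintro _ ⟨c, hc0, rfl⟩
      exact ⟨-c, by simpa using hc0, map_neg T c⟩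
  refine (iInf₂_le _ hF).trans (iSup₂_le ?_)
  rintro _ ⟨c, hc0, rfl⟩
  refine ENNReal.div_le_of_le_mul ?_
  rw [hb]
  exact ha c

end Span

/-! ### Separated boundary points -/

section Packing

variable {m : ℕ} {Ω : Set (EuclideanSpace ℝ (Fin (m + 1)))}

theorem perimeter_ne_top (ho : IsOpen Ω) (hc : Convex ℝ Ω) (hb : Bornology.IsBounded Ω) :
    perimeter Ω ≠ ⊤ := by
  obtain ⟨R, hR⟩ := hb.closure.subset_ball 0
  have h1 : frontier Ω ⊆ frontier Ω ∩ Metric.ball 0 (max R 1) := fun y hy =>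
    ⟨hy, Metric.ball_subset_ball (le_max_left _ _) (hR (frontier_subset_closure hy))⟩
  have h2 := (measure_mono (μ := Measure.euclideanHausdorffMeasure m) h1).trans
    (frontier_inter_ball_le ho hc 0 (R := max R 1) (by positivity))
  exact (h2.trans_lt ENNReal.ofReal_lt_top).ne

/-- If the boundary is too large to be covered by fewer than `k` balls of radius `2 * r`, a greedy
choice finds `k` boundary points at mutual distance at least `2 * r`. -/
theorem exists_separated_points (ho : IsOpen Ω) (hc : Convex ℝ Ω) {r : ℝ} (hr : 0 < r) {k : ℕ}
    (hk : ENNReal.ofReal (k * (2 * (m + 1) * 4 ^ m) * r ^ m) ≤ perimeter Ω) :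
    ∃ x : Fin k → EuclideanSpace ℝ (Fin (m + 1)), (∀ i, x i ∈ frontier Ω) ∧
      ∀ i j, i ≠ j → 2 * r ≤ dist (x i) (x j) := by
  classical
  have h1 : ∀ j ≤ k, ∃ T : Finset (EuclideanSpace ℝ (Fin (m + 1))), T.card = j ∧
      (∀ y ∈ T, y ∈ frontier Ω) ∧ ∀ y ∈ T, ∀ z ∈ T, y ≠ z → 2 * r ≤ dist y z := by
    intro j
    induction j with
    | zero => exact fun _ => ⟨∅, by simp⟩
    | succ j ih =>
      intro hj
      obtain ⟨T, hTc, hTf, hTd⟩ := ih (by omega)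
      obtain ⟨y, hy, hyT⟩ : ∃ y ∈ frontier Ω, ∀ z ∈ T, 2 * r ≤ dist y z := by
        by_contra! h
        have h2 : frontier Ω ⊆ ⋃ z ∈ T, frontier Ω ∩ Metric.ball z (2 * r) := fun y hy => by
          obtain ⟨z, hz, hyz⟩ := h y hy
          exact Set.mem_iUnion₂.2 ⟨z, hz, hy, hyz⟩
        have h3 : perimeter Ω ≤ ENNReal.ofReal (j * (2 * (m + 1) * 4 ^ m) * r ^ m) := by
          refine (measure_mono (μ := Measure.euclideanHausdorffMeasure m) h2).trans
            ((measure_biUnion_finset_le _ _).trans ((Finset.sum_le_sum fun z _ =>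
              frontier_inter_ball_le ho hc z (R := 2 * r) (by positivity)).trans_eq ?_))
          rw [Finset.sum_const, hTc, nsmul_eq_mul, ← ENNReal.ofReal_natCast,
            ← ENNReal.ofReal_mul (by positivity)]
          congr 1
          have h4 : (2 * (2 * r)) ^ m = 4 ^ m * r ^ m := by rw [← mul_pow]; ring_nf
          rw [h4]
          ring
        have h4 := hk.trans h3
        rw [ENNReal.ofReal_le_ofReal_iff (by positivity)] at h4
        have h5 : (j : ℝ) + 1 ≤ k := by exact_mod_cast hj
        have h6 : 0 < (2 * ((m : ℝ) + 1) * 4 ^ m) * r ^ m := by positivity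
        nlinarith
      have hyn : y ∉ T := fun h => by
        have := hyT y h
        rw [dist_self] at this
        linarith
      refine ⟨insert y T, by rw [Finset.card_insert_of_notMem hyn, hTc], ?_, ?_⟩
      · exact Finset.forall_mem_insert _ _ _ |>.2 ⟨hy, hTf⟩
      · intro a ha b hb hab
        rcases Finset.mem_insert.1 ha with rfl | ha' <;>
          rcases Finset.mem_insert.1 hb with rfl | hb'
        · exact absurd rfl hab
        · exact hyT b hb'
        · rw [dist_comm]; exact hyT a ha'
        · exact hTd a ha' b hb' hab
  obtain ⟨T, hTc, hTf, hTd⟩ := h1 k le_rfl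
  let e := (T.equivFinOfCardEq hTc).symm
  exact ⟨fun i => e i, fun i => hTf _ (e i).2, fun i j hij => hTd _ (e i).2 _ (e j).2 fun h =>
    hij (e.injective (Subtype.ext h))⟩

end Packing

/-! ### Bumps, and the eigenvalue bound -/

section Bump

variable {n : ℕ}

/-- A smooth bump at the origin: `1` on the ball of radius `1 / 2`, and supported in the ball of
radius `3 / 4`, so that bumps with `2`-separated centers have disjoint closed supports. -/
noncomputable def unitBump (n : ℕ) : ContDiffBump (0 : EuclideanSpace ℝ (Fin n)) :=
  ⟨1 / 2, 3 / 4, by norm_num, by norm_num⟩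

/-- The bump at `x` of scale `r`. -/
noncomputable def bump (x : EuclideanSpace ℝ (Fin n)) (r : ℝ) (y : EuclideanSpace ℝ (Fin n)) : ℝ :=
  unitBump n (r⁻¹ • (y - x))

variable {x : EuclideanSpace ℝ (Fin n)} {r : ℝ}

theorem contDiff_bump : ContDiff ℝ ∞ (bump x r) :=
  (unitBump n).contDiff.comp ((contDiff_id.sub contDiff_const).const_smul _)

theorem tsupport_bump_subset (hr : 0 < r) :
    tsupport (bump x r) ⊆ Metric.closedBall x (3 / 4 * r) := by
  refine closure_minimal (fun y hy => ?_) Metric.isClosed_closedBall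
  have h1 : r⁻¹ • (y - x) ∈ Function.support (unitBump n) := hy
  rw [ContDiffBump.support_eq, mem_ball_zero_iff, norm_smul,
    Real.norm_of_nonneg (by positivity)] at h1
  have h2 : r⁻¹ * ‖y - x‖ < 3 / 4 := h1
  rw [inv_mul_lt_iff₀ hr] at h2
  rw [Metric.mem_closedBall, dist_eq_norm]
  linarith

theorem hasCompactSupport_bump (hr : 0 < r) : HasCompactSupport (bump x r) :=
  (isCompact_closedBall x (3 / 4 * r)).of_isClosed_subset (isClosed_tsupport _)
    (tsupport_bump_subset hr)

theorem bump_eq_one (hr : 0 < r) {y : EuclideanSpace ℝ (Fin n)}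
    (hy : y ∈ Metric.ball x (r / 2)) : bump x r y = 1 := by
  refine (unitBump n).one_of_mem_closedBall ?_
  rw [mem_closedBall_zero_iff, norm_smul, Real.norm_of_nonneg (by positivity)]
  show r⁻¹ * ‖y - x‖ ≤ 1 / 2
  rw [Metric.mem_ball, dist_eq_norm] at hy
  rw [inv_mul_le_iff₀ hr]
  linarith

theorem exists_norm_gradient_bump_le (n : ℕ) : ∃ M : ℝ, 0 < M ∧
    ∀ (x : EuclideanSpace ℝ (Fin n)) (r : ℝ), 0 < r → ∀ y, ‖gradient (bump x r) y‖ ≤ M / r := by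
  obtain ⟨M, hM⟩ := ((unitBump n).hasCompactSupport.fderiv ℝ).exists_bound_of_continuous
    ((unitBump n).contDiff.continuous_fderiv (n := 1) (by simp))
  refine ⟨max M 1, by positivity, fun x r hr y => ?_⟩
  have h1 : HasFDerivAt (fun y : EuclideanSpace ℝ (Fin n) => r⁻¹ • (y - x))
      (r⁻¹ • ContinuousLinearMap.id ℝ _) y := ((hasFDerivAt_id y).sub_const x).const_smul r⁻¹
  have h2 : DifferentiableAt ℝ (unitBump n) (r⁻¹ • (y - x)) :=
    ((unitBump n).contDiff (n := 1)).differentiable (by simp) _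
  have h3 : HasFDerivAt (bump x r) _ y := h2.hasFDerivAt.comp y h1
  rw [gradient, LinearIsometryEquiv.norm_map, h3.fderiv, ContinuousLinearMap.comp_smul,
    ContinuousLinearMap.comp_id, norm_smul, Real.norm_of_nonneg (by positivity), div_eq_inv_mul]
  gcongr
  exact (hM _).trans (le_max_left _ _)

theorem lintegral_gradient_bump_le {Ω : Set (EuclideanSpace ℝ (Fin n))} {M : ℝ} (hr : 0 < r)
    (hM : ∀ y, ‖gradient (bump x r) y‖ ≤ M / r) {q : ℝ} (hq : 0 < q) :
    ∫⁻ y in Ω, ‖gradient (bump x r) y‖ₑ ^ q ≤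
      ENNReal.ofReal ((M / r) ^ q) * volume (Ω ∩ Metric.ball x r) := by
  have hMr : 0 ≤ M / r := (norm_nonneg _).trans (hM x)
  have h1 : ∀ y, ‖gradient (bump x r) y‖ₑ ^ q ≤
      (Metric.ball x r).indicator (fun _ => ENNReal.ofReal ((M / r) ^ q)) y := by
    intro y
    by_cases hy : y ∈ Metric.ball x r
    · rw [Set.indicator_of_mem hy, ← ENNReal.ofReal_rpow_of_nonneg hMr hq.le, ← ofReal_norm]
      gcongr
      exact hM y
    · have h2 : y ∉ tsupport (bump x r) := fun h => hy
        (Metric.closedBall_subset_ball (by linarith) (tsupport_bump_subset hr h))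
      rw [gradient_of_notMem_tsupport h2, enorm_zero, ENNReal.zero_rpow_of_pos hq]
      exact zero_le
  refine (lintegral_mono h1).trans_eq ?_
  rw [lintegral_indicator_const measurableSet_ball, Measure.restrict_apply measurableSet_ball,
    Set.inter_comm]

theorem le_lintegral_bump {Ω : Set (EuclideanSpace ℝ (Fin n))} (hr : 0 < r) (q : ℝ) :
    Measure.euclideanHausdorffMeasure (n - 1) (frontier Ω ∩ Metric.ball x (r / 2)) ≤
      ∫⁻ y, ‖bump x r y‖ₑ ^ q ∂(surfaceMeasure Ω) := by
  have h1 : ∀ y, (Metric.ball x (r / 2)).indicator (fun _ => (1 : ℝ≥0∞)) y ≤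
      ‖bump x r y‖ₑ ^ q := by
    intro y
    by_cases hy : y ∈ Metric.ball x (r / 2)
    · rw [Set.indicator_of_mem hy, bump_eq_one hr hy]
      simp
    · rw [Set.indicator_of_notMem hy]
      exact zero_le
  refine le_trans (le_of_eq ?_) (lintegral_mono h1)
  rw [lintegral_indicator_const measurableSet_ball, surfaceMeasure,
    Measure.restrict_apply measurableSet_ball, Set.inter_comm, one_mul]

theorem lintegral_bump_le {Ω : Set (EuclideanSpace ℝ (Fin n))} {q : ℝ} (hq : 0 ≤ q) :
    ∫⁻ y, ‖bump x r y‖ₑ ^ q ∂(surfaceMeasure Ω) ≤ perimeter Ω := by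
  refine (lintegral_mono (g := fun _ => 1) fun y => ?_).trans_eq ?_
  · refine ENNReal.rpow_le_one ?_ hq
    rw [bump, Real.enorm_of_nonneg (unitBump n).nonneg]
    exact ENNReal.ofReal_le_one.2 (unitBump n).le_one
  · rw [lintegral_one, surfaceMeasure, Measure.restrict_apply_univ, perimeter]

end Bump

end SteklovP

theorem corollary3p1 (n : ℕ) (hn : 2 ≤ n) (p : ℝ) (hp : (n : ℝ) < p)
    [Fact (1 ≤ ENNReal.ofReal p)] :
    ∃ C : ℝ, 0 < C ∧
      ∀ Ω : Set (EuclideanSpace ℝ (Fin n)), IsOpen Ω → Ω.Nonempty → Bornology.IsBounded Ω →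
        Convex ℝ Ω → ∀ k : ℕ, 1 ≤ k →
          SteklovP.steklovEigenvalue (ENNReal.ofReal p) Ω k ≤
            ENNReal.ofReal C *
              ((k : ℝ≥0∞) / SteklovP.perimeter Ω) ^ ((p - 1) / ((n : ℝ) - 1)) := by
  obtain ⟨m, rfl⟩ : ∃ m, n = m + 1 := ⟨n - 1, by omega⟩
  have hm : (0 : ℝ) < m := by exact_mod_cast (by omega : 0 < m)
  have hp1 : 1 < p := by
    push_cast at hp
    linarith
  have hpp : (ENNReal.ofReal p).toReal = p := ENNReal.toReal_ofReal (by linarith)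
  have hexp : ((m + 1 : ℕ) : ℝ) - 1 = m := by push_cast; ring
  rw [hexp]
  set s : ℝ := (p - 1) / m with hs
  have hs0 : 0 < s := div_pos (by linarith) hm
  obtain ⟨M, hM0, hM⟩ := SteklovP.exists_norm_gradient_bump_le (m + 1)
  set K : ℝ := (2 * (m + 2)) ^ (m + 1) with hK
  set D : ℝ := 2 * (m + 1) * 4 ^ m with hD
  have hK0 : 0 < K := by positivity
  have hD0 : 0 < D := by positivity
  refine ⟨M ^ p * K * D ^ s, by positivity, ?_⟩
  intro Ω ho _ hb hc k hk
  have hk0 : (0 : ℝ) < k := by exact_mod_cast hk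
  set P := SteklovP.perimeter Ω with hP
  have hPtop : P ≠ ⊤ := SteklovP.perimeter_ne_top ho hc hb
  rcases eq_or_ne P 0 with hP0 | hP0
  · -- This case does not occur, but the right-hand side is infinite here in any event.
    have h1 : (k : ℝ≥0∞) ≠ 0 := by exact_mod_cast (by omega : k ≠ 0)
    rw [hP0, ENNReal.div_zero h1, ENNReal.top_rpow_of_pos hs0, ENNReal.mul_top]
    · exact le_top
    · exact (ENNReal.ofReal_pos.2 (by positivity)).ne'
  have hPr : 0 < P.toReal := ENNReal.toReal_pos hP0 hPtop
  -- At this scale, fewer than `k` balls of radius `2 * r` cannot cover the boundary.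
  set r : ℝ := (P.toReal / (k * D)) ^ (1 / (m : ℝ)) with hr
  have hr0 : 0 < r := by positivity
  have hrm : k * D * r ^ m = P.toReal := by
    rw [hr, ← Real.rpow_natCast, ← Real.rpow_mul (by positivity), one_div_mul_cancel hm.ne',
      Real.rpow_one]
    field_simp
  obtain ⟨x, hxf, hxd⟩ := SteklovP.exists_separated_points (k := k) ho hc hr0
    (by rw [hrm]; exact ENNReal.ofReal_toReal_le)
  have hhalf : ∀ i, volume (Ω ∩ Metric.ball (x i) r) ≤ ENNReal.ofReal (K * r) *
      ∫⁻ y, ‖SteklovP.bump (x i) r y‖ₑ ^ p ∂(SteklovP.surfaceMeasure Ω) := by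
    intro i
    have h1 := SteklovP.le_lintegral_bump (Ω := Ω) (x := x i) hr0 p
    rw [Nat.add_sub_cancel] at h1
    have h2 := SteklovP.volume_inter_ball_le_half ho hc (hxf i) hr0
    rw [← hK] at h2
    exact h2.trans (mul_le_mul_right h1 _)
  have hmain : SteklovP.steklovEigenvalue (ENNReal.ofReal p) Ω k ≤
      ENNReal.ofReal ((M / r) ^ p * (K * r)) := by
    refine SteklovP.steklovEigenvalue_le (u := fun i => SteklovP.bump (x i) r) ENNReal.ofReal_ne_top
      (fun y hy ρ hρ => (SteklovP.volume_inter_ball_pos ho hy hρ).ne')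
      (fun i => SteklovP.contDiff_bump) (fun i => SteklovP.hasCompactSupport_bump hr0) ?_ ?_ ?_ ?_
    · intro i j hij
      refine Set.disjoint_of_subset (SteklovP.tsupport_bump_subset hr0)
        (SteklovP.tsupport_bump_subset hr0) (Metric.closedBall_disjoint_closedBall ?_)
      linarith [hxd i j hij]
    · intro i h0
      rw [hpp] at h0
      have h1 := hhalf i
      rw [h0, mul_zero] at h1
      exact (SteklovP.volume_inter_ball_pos ho (hxf i) hr0).not_ge h1
    · intro i
      rw [hpp]
      exact ((SteklovP.lintegral_bump_le (by linarith)).trans_lt hPtop.lt_top).ne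
    · intro i
      rw [hpp, ENNReal.ofReal_mul (by positivity), mul_assoc]
      exact (SteklovP.lintegral_gradient_bump_le hr0 (hM (x i) r hr0) (by linarith)).trans
        (mul_le_mul_right (hhalf i) _)
  refine hmain.trans_eq ?_
  have h1 : (k : ℝ≥0∞) / P = ENNReal.ofReal (k / P.toReal) := by
    rw [ENNReal.ofReal_div_of_pos hPr, ENNReal.ofReal_natCast, ENNReal.ofReal_toReal hPtop]
  rw [h1, ENNReal.ofReal_rpow_of_pos (by positivity), ← ENNReal.ofReal_mul (by positivity)]
  congr 1
  have h2 : r ^ (1 - p) = D ^ s * (k / P.toReal) ^ s := by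
    rw [hr, ← Real.rpow_mul (by positivity), ← Real.mul_rpow (by positivity) (by positivity)]
    have h3 : D * (k / P.toReal) = (P.toReal / (k * D))⁻¹ := by
      rw [inv_div]; ring
    rw [h3, Real.inv_rpow (by positivity), ← Real.rpow_neg (by positivity)]
    congr 1
    rw [hs]; ring
  rw [Real.div_rpow hM0.le hr0.le, mul_assoc (M ^ p * K), ← h2, Real.rpow_sub hr0, Real.rpow_one]
  ring
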